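/- Let $0 < r < r'$, and let $\mathcal S$, $\mathcal S'$ be round two-dimensional spheres of radius $r$ and $r'$ in $\mathbb R^3$. A chain on a sphere is a sequence of vertices $v_0,\dots,v_n$ in which consecutive vertices are joined by the edges $e_i=v_{i-1}v_i$ $(1\le i\le n)$, where an edge is the shorter great-circle arc between two distinct, non-antipodal points. Its angles are the angles $\theta_i\in[0,\pi]$ between $e_i$ and $e_{i+1}$ at $v_i$, for $1\le i\le n-1$. The chain is convex if adding the edge $v_nv_0$ gives a convex polygon, that is: the vertices $v_0,\dots,v_n$ are distinct and do not all lie on one great circle, consecutive vertices (including $v_n,v_0$) are not antipodal, and, for one of the two directions of traversal, all vertices lie in the closed hemisphere to the left of each edge of the polygon. (Angles equal to $\pi$ are allowed; necessarily $n\ge 2$.) Let $\mathcal C=(v_0,\dots,v_n)$ be a convex chain on $\mathcal S$, and let $\mathcal C'=(v_0',\dots,v_n')$ be a convex chain on $\mathcal S'$ with the same edge lengths and the same angles, i.e. $|v'_{i-1}v'_i|=|v_{i-1}v_i|$ for $1\le i\le n$ and $\theta'_i=\theta_i$ for $1\le i\le n-1$, where $|xy|$ denotes the great-circle distance on the respective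 sphere. Then $$|v'_0v'_n|>|v_0v_n| .$$ -/

import Mathlib

/-- Euclidean three-space, in which the sphere of radius `r` is `Metric.sphere 0 r`. -/
abbrev E3 : Type := EuclideanSpace ℝ (Fin 3)

/-- The distance of `x` and `y` on the sphere of radius `r` about the origin: the length of the
shorter arc of a great circle from `x` to `y`. -/
noncomputable def sphereDist (r : ℝ) (x y : E3) : ℝ :=
  r * InnerProductGeometry.angle x y

/-- The direction in which the shorter great-circle arc from `x` to `y` leaves `x`: the component
of `y` orthogonal to `x`, a vector tangent to the sphere at `x`. It is nonzero if `x` and `y` are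
distinct and not antipodal. -/
noncomputable def arcDirection (x y : E3) : E3 :=
  y - (inner ℝ x y / inner ℝ x x) • x

/-- The angle in `[0, π]` at the vertex `y` between the great-circle arcs `yx` and `yz`. -/
noncomputable def sphereAngle (x y z : E3) : ℝ :=
  InnerProductGeometry.angle (arcDirection y x) (arcDirection y z)

/-- The triple product of `x`, `y`, `z`. If `x`, `y` are distinct and not antipodal, its sign
says on which side of the oriented great circle from `x` to `y` the point `z` lies; it vanishes
when `z` lies on that great circle. -/
noncomputable def tripleProduct (x y z : E3) : ℝ :=
  Matrix.det !![x 0, x 1, x 2; y 0, y 1, y 2; z 0, z 1, z 2]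

/-- The points `v 0, …, v n` are, in this cyclic order, the vertices of a convex polygon on the
sphere of radius `r` about the origin. The edges are the shorter great-circle arcs from `v i` to
`v (i + 1)`, where the addition in `Fin (n + 1)` is cyclic: the last edge joins `v n` to `v 0`.
Interior angles equal to `π` are allowed. The last condition says that the polygon is not
degenerate; it forces `2 ≤ n`. -/
structure IsConvexSphericalPolygon (r : ℝ) {n : ℕ} (v : Fin (n + 1) → E3) : Prop where
  /-- The vertices lie on the sphere. -/
  mem_sphere : ∀ i, v i ∈ Metric.sphere (0 : E3) r
  /-- The vertices are distinct. -/
  injective : Function.Injective v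
  /-- The endpoints of an edge are not antipodal, so that they determine the edge. -/
  not_antipodal : ∀ i, v (i + 1) ≠ -v i
  /-- On a walk around the polygon in one of the two directions, all vertices lie in the closed
  hemisphere to the left of each edge. -/
  support : (∀ i k, 0 ≤ tripleProduct (v i) (v (i + 1)) (v k)) ∨
    (∀ i k, tripleProduct (v i) (v (i + 1)) (v k) ≤ 0)
  /-- The vertices do not all lie on one great circle. -/
  not_great_circle : ¬ ∃ u : E3, u ≠ 0 ∧ ∀ i, inner ℝ u (v i) = 0

/-- The chain `v 0, …, v n` with edges `v (i - 1) v i`, `1 ≤ i ≤ n`, on the sphere of radius `r`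
about the origin is convex: the polygon that arises when the edge `v n v 0` is added is convex. -/
def IsConvexChain (r : ℝ) {n : ℕ} (v : Fin (n + 1) → E3) : Prop :=
  IsConvexSphericalPolygon r v

/-- Two chains, on the spheres of radius `r` and `r'`, have the same edge lengths. -/
def SameEdgeLengths (r r' : ℝ) {n : ℕ} (v v' : Fin (n + 1) → E3) : Prop :=
  ∀ i : Fin n, sphereDist r' (v' i.castSucc) (v' i.succ) = sphereDist r (v i.castSucc) (v i.succ)

/-- Two chains have the same angles at all their inner vertices `v 1, …, v (n - 1)`. -/
def SameAngles {n : ℕ} (v v' : Fin (n + 1) → E3) : Prop :=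
  ∀ i : Fin (n + 1), i ≠ 0 → i ≠ Fin.last n →
    sphereAngle (v' (i - 1)) (v' i) (v' (i + 1)) = sphereAngle (v (i - 1)) (v i) (v (i + 1))

open Matrix

namespace SphericalChain

/-! Dividing by the radius turns both chains into chains on the unit sphere with edges `k * ℓ m` and
exterior angles `τ m`, where `k` is the inverse radius. If D(k) is the distance of the ends of this
model chain, the claim is that D(k)/k increases when k decreases. Only the convexity of the chain on
the smaller sphere enters the comparison `chord_div_lt`; that of the other chain serves to identify
it with the model.

First variation. When k grows with unit speed, edge m turns the rest of the chain about its pole n_m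
with speed ℓ_m. With u = x_q × x_p this gives D' = -(∑ ℓ_m n_m · u) / sin D. So D/k has negative
derivative as soon as the sum of length times pole over all edges of the polygon, the closing edge
included, has positive product with u (`edgeMoment_polygon_pos`). The polygon is cut into a fan of
triangles with apex p; the contributions of the diagonals cancel. For one triangle the statement
reduces to a cos β + b cos α < c (`triangle_projection`), which follows from the decrease of t cot t
on (0, π).

Loss of convexity. The variation argument needs a convex polygon with strict corners at both ends of
the chain, and this is an open condition on k (`eventually_orderedConvex`): triple products of
vertices that vanish come from straight runs, and these stay straight at every scale. Going down
from the given k, either the condition holds until k' is reached, or there is a first scale where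
the polygon is still convex in the weak sense but an end corner is straight. Then this end lies on
the arc between its neighbour and the other end, so it can be removed: induction applies to the
shorter chain, and the triangle inequality at scale k' restores the removed edge
(`chord_div_lt_of_between`). -/

/-- Coordinate vectors in three-space. -/
abbrev V3 : Type := Fin 3 → ℝ

/-! ### Triple products and planes through the origin -/

/-- The triple product of coordinate vectors. -/
def trip (a b c : V3) : ℝ := a ⬝ᵥ (b ⨯₃ c)

theorem trip_eq (a b c : V3) : trip a b c =
    a 0 * (b 1 * c 2 - b 2 * c 1) + a 1 * (b 2 * c 0 - b 0 * c 2)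
      + a 2 * (b 0 * c 1 - b 1 * c 0) := by
  simp [trip, dotProduct, Fin.sum_univ_three, cross_apply]

theorem dot_eq (a b : V3) : a ⬝ᵥ b = a 0 * b 0 + a 1 * b 1 + a 2 * b 2 := by
  simp [dotProduct, Fin.sum_univ_three]

theorem trip_rot (a b c : V3) : trip a b c = trip b c a := by simp only [trip_eq]; ring

theorem trip_swap (a b c : V3) : trip a b c = -trip a c b := by simp only [trip_eq]; ring

theorem trip_left_eq (a b : V3) : trip a a b = 0 := by simp only [trip_eq]; ring

theorem trip_right_eq (a b : V3) : trip a b b = 0 := by simp only [trip_eq]; ring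

theorem trip_outer_eq (a b : V3) : trip a b a = 0 := by simp only [trip_eq]; ring

theorem dot_cross (a b c : V3) : (a ⨯₃ b) ⬝ᵥ c = trip a b c := by
  simp [trip, dotProduct, Fin.sum_univ_three, cross_apply]; ring

/-- The Grassmann–Plücker relation. It propagates the signs of triple products from neighbouring
vertices to distant ones and so replaces arguments about the order of directions around `a`. -/
theorem trip_pluecker (a b c d e : V3) :
    trip a b c * trip a d e - trip a b d * trip a c e + trip a b e * trip a c d = 0 := by
  simp only [trip_eq]; ring

theorem trip_comb_left (α β : ℝ) (a b c d : V3) :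
    trip (α • a + β • b) c d = α * trip a c d + β * trip b c d := by
  simp only [trip_eq, Pi.add_apply, Pi.smul_apply, smul_eq_mul]; ring

theorem trip_comb_mid (α β : ℝ) (a b c d : V3) :
    trip c (α • a + β • b) d = α * trip c a d + β * trip c b d := by
  simp only [trip_eq, Pi.add_apply, Pi.smul_apply, smul_eq_mul]; ring

theorem trip_comb_right (α β : ℝ) (a b c d : V3) :
    trip c d (α • a + β • b) = α * trip c d a + β * trip c d b := by
  simp only [trip_eq, Pi.add_apply, Pi.smul_apply, smul_eq_mul]; ring

theorem eq_of_dot_self_sub_eq_zero {a b : V3} (h : (a - b) ⬝ᵥ (a - b) = 0) : a = b :=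
  sub_eq_zero.mp (dotProduct_self_eq_zero.mp h)

theorem dot_self_pos {a : V3} (h : a ≠ 0) : 0 < a ⬝ᵥ a := by
  have h1 : a ⬝ᵥ a ≠ 0 := fun h2 => h (dotProduct_self_eq_zero.mp h2)
  have h2 : 0 ≤ a ⬝ᵥ a := by rw [dot_eq]; nlinarith [sq_nonneg (a 0), sq_nonneg (a 1), sq_nonneg (a 2)]
  exact lt_of_le_of_ne h2 (Ne.symm h1)

theorem cross_dot_self (a b : V3) :
    (a ⨯₃ b) ⬝ᵥ (a ⨯₃ b) = (a ⬝ᵥ a) * (b ⬝ᵥ b) - (a ⬝ᵥ b) ^ 2 := by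
  rw [cross_dot_cross, dotProduct_comm b a]; ring

theorem eq_or_eq_neg_of_cross_eq_zero {a b : V3} (ha : a ⬝ᵥ a = 1) (hb : b ⬝ᵥ b = 1)
    (h : a ⨯₃ b = 0) : b = a ∨ b = -a := by
  have h1 := cross_dot_self a b
  rw [h, ha, hb, zero_dotProduct] at h1
  have h2 : (a ⬝ᵥ b - 1) * (a ⬝ᵥ b + 1) = 0 := by linarith
  rcases mul_eq_zero.mp h2 with h3 | h3
  · left
    apply eq_of_dot_self_sub_eq_zero
    rw [dot_eq] at *
    simp only [Pi.sub_apply]; linarith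
  · right
    apply eq_of_dot_self_sub_eq_zero
    rw [dot_eq] at *
    simp only [Pi.sub_apply, Pi.neg_apply]; linarith

theorem exists_comb_of_trip_eq_zero {a b c : V3} (hab : a ⨯₃ b ≠ 0) (h : trip a b c = 0) :
    ∃ α β : ℝ, c = α • a + β • b := by
  have hp := dot_self_pos hab
  have hne := hp.ne'
  rw [cross_dot_self] at hp hne
  -- Cramer's rule for the two equations obtained by pairing with `a` and `b`; the denominator is
  -- their Gram determinant.
  refine ⟨((c ⬝ᵥ a) * (b ⬝ᵥ b) - (c ⬝ᵥ b) * (a ⬝ᵥ b)) / ((a ⬝ᵥ a) * (b ⬝ᵥ b) - (a ⬝ᵥ b) ^ 2),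
    ((c ⬝ᵥ b) * (a ⬝ᵥ a) - (c ⬝ᵥ a) * (a ⬝ᵥ b)) / ((a ⬝ᵥ a) * (b ⬝ᵥ b) - (a ⬝ᵥ b) ^ 2), ?_⟩
  rw [trip_eq] at h
  ext i
  simp only [Pi.add_apply, Pi.smul_apply, smul_eq_mul]
  rw [div_mul_eq_mul_div, div_mul_eq_mul_div, ← add_div, eq_div_iff hne]
  simp only [dot_eq] at *
  fin_cases i
  · simp only [Fin.zero_eta]
    linear_combination (a 1 * b 2 - a 2 * b 1) * h
  · simp only [Fin.mk_one]
    linear_combination (a 2 * b 0 - a 0 * b 2) * h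
  · simp only [Fin.reduceFinMk]
    linear_combination (a 0 * b 1 - a 1 * b 0) * h

/-- For `a`, `b` in the plane orthogonal to `u`, the vector `a × b` is a multiple of `u`. -/
theorem dot_self_mul_trip {u a b : V3} (ha : u ⬝ᵥ a = 0) (hb : u ⬝ᵥ b = 0) (w : V3) :
    (u ⬝ᵥ u) * trip w a b = trip u a b * (u ⬝ᵥ w) := by
  simp only [dot_eq, trip_eq] at *
  linear_combination
    (u 0 * (w 1 * a 2 - w 2 * a 1) + u 1 * (w 2 * a 0 - w 0 * a 2)
      + u 2 * (w 0 * a 1 - w 1 * a 0)) * hb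
    - (u 0 * (w 1 * b 2 - w 2 * b 1) + u 1 * (w 2 * b 0 - w 0 * b 2)
      + u 2 * (w 0 * b 1 - w 1 * b 0)) * ha

theorem cross_eq_zero_of_trip_eq_zero {u a b : V3} (hu : u ≠ 0) (ha : u ⬝ᵥ a = 0)
    (hb : u ⬝ᵥ b = 0) (h : trip u a b = 0) : a ⨯₃ b = 0 := by
  have h1 := dot_self_mul_trip ha hb (a ⨯₃ b)
  rw [h, zero_mul] at h1
  exact dotProduct_self_eq_zero.mp ((mul_eq_zero.mp h1).resolve_left (dot_self_pos hu).ne')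

/-! ### From supporting edges to all ordered triples -/

section Support

variable {N : ℕ} {y : ℕ → V3}

/-- If a closed polygon lies to the left of each of its edges, then the triple products of its
vertices are nonnegative for the triples that start at the vertex `0` and follow the order. -/
theorem trip_nonneg_of_support (hper : ∀ i, y (i + N) = y i) (hunit : ∀ i, y i ⬝ᵥ y i = 1)
    (hinj : ∀ i j, i < j → j < i + N → y i ≠ y j) (hstep : ∀ i, y i ⨯₃ y (i + 1) ≠ 0)
    (hsup : ∀ i l, 0 ≤ trip (y i) (y (i + 1)) (y l))
    (hgc : ∃ l < N, 0 < trip (y 0) (y 1) (y l)) {j l : ℕ} (hj : 0 < j) (hjl : j < l)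
    (hl : l < N) : 0 ≤ trip (y 0) (y j) (y l) := by
  set u := y 0 ⨯₃ y 1 with hu
  have hu0 : u ≠ 0 := hstep 0
  have hup := dot_self_pos hu0
  have hh : ∀ i, u ⬝ᵥ y i = trip (y 0) (y 1) (y i) := fun i => dot_cross _ _ _
  have hnn : ∀ i, 0 ≤ u ⬝ᵥ y i := fun i => by rw [hh]; exact hsup 0 i
  have h0 : u ⬝ᵥ y 0 = 0 := by rw [hh, trip_outer_eq]
  have h1 : u ⬝ᵥ y 1 = 0 := by rw [hh, trip_right_eq]
  obtain ⟨l0, hl0N, hl0⟩ := hgc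
  rw [← hh] at hl0
  have hN0 : u ⬝ᵥ y N = 0 := by rw [← h0, ← hper 0, zero_add]
  -- the first vertex off the great circle
  have hex : ∃ i, 0 < u ⬝ᵥ y i := ⟨l0, hl0⟩
  obtain ⟨f, hf, hfmin⟩ : ∃ f, 0 < u ⬝ᵥ y f ∧ ∀ i < f, u ⬝ᵥ y i = 0 :=
    ⟨Nat.find hex, Nat.find_spec hex, fun i hi =>
      le_antisymm (not_lt.mp (Nat.find_min hex hi)) (hnn i)⟩
  have hfl : f ≤ l0 := by
    by_contra hcon
    exact hl0.ne' (hfmin _ (by omega))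
  have hf2 : 2 ≤ f := by
    by_contra hcon
    have : f = 0 ∨ f = 1 := by omega
    rcases this with rfl | rfl <;> linarith
  -- the first vertex of the last run on the great circle
  have hexs : ∃ s, s ≤ N ∧ ∀ i, s ≤ i → i ≤ N → u ⬝ᵥ y i = 0 :=
    ⟨N, le_rfl, fun i h1 h2 => by rw [le_antisymm h2 h1]; exact hN0⟩
  obtain ⟨s, hsN, hs, hsmin⟩ : ∃ s, s ≤ N ∧ (∀ i, s ≤ i → i ≤ N → u ⬝ᵥ y i = 0) ∧
      (0 < s → 0 < u ⬝ᵥ y (s - 1)) := by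
    refine ⟨Nat.find hexs, (Nat.find_spec hexs).1, (Nat.find_spec hexs).2, fun hpos => ?_⟩
    refine lt_of_le_of_ne (hnn _) fun h => ?_
    refine Nat.find_min hexs (m := Nat.find hexs - 1) (by omega)
      ⟨by have := (Nat.find_spec hexs).1; omega, fun i hi1 hi2 => ?_⟩
    rcases eq_or_lt_of_le hi1 with h3 | h3
    · rw [← h3, ← h]
    · exact (Nat.find_spec hexs).2 i (by omega) hi2
  have hfs : f < s := by
    by_contra hcon
    exact hf.ne' (hs f (by omega) (by omega))
  -- Where the polygon comes down to the great circle of the first edge, the edge that arrives there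
  -- supports it. Hence all vertices on this circle lie within a half turn ahead of the arrival
  -- point.
  have hstart : ∀ j, 0 < j → 0 < u ⬝ᵥ y (j - 1) → u ⬝ᵥ y j = 0 → ∀ w, u ⬝ᵥ y w = 0 →
      0 ≤ trip u (y j) (y w) := by
    intro j hj hj1 hj0 w hw
    have h2 := hsup (j - 1) w
    rw [Nat.sub_add_cancel hj] at h2
    have h3 := dot_self_mul_trip hj0 hw (y (j - 1))
    have h4 : 0 ≤ trip u (y j) (y w) * (u ⬝ᵥ y (j - 1)) := by rw [← h3]; positivity
    exact nonneg_of_mul_nonneg_left h4 hj1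
  have hpar : ∀ i j, u ⬝ᵥ y i = 0 → u ⬝ᵥ y j = 0 → trip u (y i) (y j) = 0 →
      y j = y i ∨ y j = -y i := fun i j hi hj h =>
    eq_or_eq_neg_of_cross_eq_zero (hunit i) (hunit j)
      (cross_eq_zero_of_trip_eq_zero hu0 hi hj h)
  have hneg : ∀ a b : V3, trip u (-a) b = -trip u a b := fun a b => by
    simp only [trip_eq, Pi.neg_apply]; ring
  -- vertices strictly between are off the great circle
  have hmid : ∀ i, f ≤ i → i < s → 0 < u ⬝ᵥ y i := by
    by_contra! hcon
    have hP : ∃ i, f ≤ i ∧ i < s ∧ u ⬝ᵥ y i = 0 := by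
      obtain ⟨i, hi1, hi2, hi3⟩ := hcon
      exact ⟨i, hi1, hi2, le_antisymm hi3 (hnn i)⟩
    obtain ⟨j, ⟨hj1, hj2, hj3⟩, hjmin⟩ : ∃ j, (f ≤ j ∧ j < s ∧ u ⬝ᵥ y j = 0) ∧
        ∀ i < j, ¬ (f ≤ i ∧ i < s ∧ u ⬝ᵥ y i = 0) :=
      ⟨Nat.find hP, Nat.find_spec hP, fun i hi => Nat.find_min hP hi⟩
    have hfj : f < j := lt_of_le_of_ne hj1 (by rintro rfl; linarith)
    have hj4 : 0 < u ⬝ᵥ y (j - 1) := lt_of_le_of_ne (hnn _) fun h =>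
      hjmin (j - 1) (by omega) ⟨by omega, by omega, h.symm⟩
    have hs0 := hs s le_rfl hsN
    have e1 := hstart j (by omega) hj4 hj3
    have e2 := hstart s (by omega) (hsmin (by omega)) hs0
    -- Two arrival points lie within a half turn ahead of each other, so they are equal or
    -- antipodal. Equality contradicts distinctness; if they are antipodal, every vertex on the
    -- circle is one of these two points, and the first edge degenerates.
    have e3 : trip u (y j) (y s) = 0 := by
      have := e1 s hs0
      have := e2 j hj3
      rw [trip_swap] at this
      linarith [trip_rot u (y j) (y s), trip_rot u (y s) (y j), trip_swap u (y s) (y j)]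
    rcases hpar j s hj3 hs0 e3 with h | h
    · exact hinj j s hj2 (by omega) h.symm
    · have e4 : ∀ w, u ⬝ᵥ y w = 0 → y j ⨯₃ y w = 0 := by
        intro w hw
        refine cross_eq_zero_of_trip_eq_zero hu0 hj3 hw ?_
        have e5 := e2 w hw
        rw [h, hneg] at e5
        linarith [e1 w hw]
      rcases eq_or_eq_neg_of_cross_eq_zero (hunit j) (hunit 0) (e4 0 h0) with h6 | h6 <;>
      rcases eq_or_eq_neg_of_cross_eq_zero (hunit j) (hunit 1) (e4 1 h1) with h7 | h7 <;>
      · refine hu0 ?_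
        rw [hu, h6, h7]
        simp
  -- The vertices on the great circle form one cyclic run, from `s` through `N`, which is the vertex
  -- `0` again, to `N + f - 1`.
  have hrun0 : ∀ i, s ≤ i → i < N + f → u ⬝ᵥ y i = 0 := by
    intro i hi1 hi2
    by_cases h : i ≤ N
    · exact hs i hi1 h
    · obtain ⟨m, rfl⟩ : ∃ m, i = m + N := ⟨i - N, by omega⟩
      rw [hper]; exact hfmin m (by omega)
  have hsteppos : ∀ i, s ≤ i → i + 1 < N + f → 0 < trip u (y i) (y (i + 1)) := by
    intro i hi1 hi2
    have e1 := hrun0 i hi1 (by omega)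
    have e2 := hrun0 (i + 1) (by omega) hi2
    have e3 := dot_self_mul_trip e1 e2 (y l0)
    have e4 := hsup i l0
    rw [← trip_rot] at e4
    have e5 : 0 ≤ trip u (y i) (y (i + 1)) :=
      nonneg_of_mul_nonneg_left (by rw [← e3]; positivity) hl0
    exact lt_of_le_of_ne e5 fun h =>
      hstep i (cross_eq_zero_of_trip_eq_zero hu0 e1 e2 h.symm)
  -- The run covers at most a half turn: all of it lies ahead of `y s`, each step goes forward, and
  -- the Plücker relation adds up the steps.
  have hrun : ∀ j i, s ≤ i → i ≤ j → j < N + f → 0 ≤ trip u (y i) (y j) := by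
    intro j
    induction j with
    | zero => intro i h1 h2; omega
    | succ j ih =>
      intro i hi1 hi2 hi3
      rcases eq_or_lt_of_le hi2 with h | h
      · rw [h, trip_right_eq]
      have e0 := hsteppos j (by omega) hi3
      have hss := hstart s (by omega) (hsmin (by omega)) (hs s le_rfl hsN)
      have e1 := hss i (hrun0 i hi1 (by omega))
      have e2 := hss (j + 1) (hrun0 _ (by omega) hi3)
      have e3 := hss j (hrun0 _ (by omega) (by omega))
      have e4 := ih i hi1 (by omega) (by omega)
      have e5 := trip_pluecker u (y s) (y i) (y j) (y (j + 1))
      rcases eq_or_lt_of_le e3 with h3 | h3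
      · rcases eq_or_lt_of_le (show s ≤ j by omega) with h4 | h4
        · have : i = j := by omega
          rw [this]; exact e0.le
        · exfalso
          rcases hpar s j (hs s le_rfl hsN) (hrun0 j (by omega) (by omega)) h3.symm with h5 | h5
          · exact hinj s j h4 (by omega) h5.symm
          · rw [h5, hneg] at e0
            linarith
      · have : 0 ≤ trip u (y s) (y j) * trip u (y i) (y (j + 1)) := by
          nlinarith [mul_nonneg e1 e0.le, mul_nonneg e2 e4]
        exact nonneg_of_mul_nonneg_right this h3
  have hy0 : y 0 = y N := by rw [← hper 0, zero_add]
  by_cases hjf : j < f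
  · have hj0 := hfmin j hjf
    have e1 := hrun (j + N) N (by omega) (by omega) (by omega)
    rw [hper, ← hy0] at e1
    have e2 := dot_self_mul_trip h0 hj0 (y l)
    rw [trip_rot] at e2
    have e3 : 0 ≤ (u ⬝ᵥ u) * trip (y 0) (y j) (y l) := by
      rw [e2]; exact mul_nonneg e1 (hnn l)
    exact nonneg_of_mul_nonneg_right e3 hup
  by_cases hls : s ≤ l
  · have hl0' := hs l hls (by omega)
    have e1 := hrun N l hls (by omega) (by omega)
    rw [← hy0] at e1
    have e2 := dot_self_mul_trip hl0' h0 (y j)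
    rw [trip_rot, trip_rot] at e2
    have e3 : 0 ≤ (u ⬝ᵥ u) * trip (y 0) (y j) (y l) := by
      rw [e2]; exact mul_nonneg e1 (hnn j)
    exact nonneg_of_mul_nonneg_right e3 hup
  -- Both vertices are now strictly left of the first edge. The directions seen from `y 0` then fill
  -- less than a half turn, so the inequalities for consecutive vertices add up by the Plücker
  -- relation.
  have hboth : ∀ l, j ≤ l → l < s → 0 ≤ trip (y 0) (y j) (y l) := by
    intro l hjl
    induction l, hjl using Nat.le_induction with
    | base => intro _; rw [trip_right_eq]
    | succ l hl ih =>
      intro hls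
      have e1 := ih (by omega)
      have e2 := hmid l (by omega) (by omega)
      have e3 := hmid j (by omega) (by omega)
      have e4 := hmid (l + 1) (by omega) (by omega)
      rw [hh] at e2 e3 e4
      have e5 := hsup l 0
      rw [← trip_rot] at e5
      have e6 := trip_pluecker (y 0) (y 1) (y j) (y l) (y (l + 1))
      have : 0 ≤ trip (y 0) (y 1) (y l) * trip (y 0) (y j) (y (l + 1)) := by
        nlinarith [mul_nonneg e3.le e5, mul_nonneg e4.le e1]
      exact nonneg_of_mul_nonneg_right this e2
  exact hboth l hjl.le (by omega)

end Support

/-! ### The inequality for one spherical triangle -/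

theorem mul_cos_mul_sin_lt {x y : ℝ} (hx : 0 < x) (hxy : x < y) (hy : y < Real.pi) :
    y * Real.cos y * Real.sin x < x * Real.cos x * Real.sin y := by
  have hanti : StrictAntiOn (fun t => t * Real.cos t / Real.sin t) (Set.Ioo 0 Real.pi) := by
    have hd : ∀ t ∈ Set.Ioo 0 Real.pi, HasDerivAt (fun t => t * Real.cos t / Real.sin t)
        (((1 * Real.cos t + t * (-Real.sin t)) * Real.sin t - t * Real.cos t * Real.cos t)
          / Real.sin t ^ 2) t := fun t ht =>
      ((hasDerivAt_id t).mul (Real.hasDerivAt_cos t)).div (Real.hasDerivAt_sin t)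
        (Real.sin_pos_of_mem_Ioo ht).ne'
    refine strictAntiOn_of_deriv_neg (convex_Ioo _ _)
      (fun t ht => (hd t ht).continuousAt.continuousWithinAt) fun t ht => ?_
    rw [interior_Ioo] at ht
    rw [(hd t ht).deriv]
    have hs := Real.sin_pos_of_mem_Ioo ht
    refine div_neg_of_neg_of_pos ?_ (by positivity)
    -- The numerator of the derivative of t cot t is sin t cos t - t.
    have h2 : Real.sin (2 * t) < 2 * t := Real.sin_lt (by linarith [ht.1])
    rw [Real.sin_two_mul] at h2
    have e : t * (Real.sin t ^ 2 + Real.cos t ^ 2) = t := by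
      rw [Real.sin_sq_add_cos_sq, mul_one]
    linarith
  have h := hanti ⟨hx, hxy.trans hy⟩ ⟨hx.trans hxy, hy⟩ hxy
  have hsx := Real.sin_pos_of_pos_of_lt_pi hx (hxy.trans hy)
  have hsy := Real.sin_pos_of_pos_of_lt_pi (hx.trans hxy) hy
  simp only at h
  rwa [div_lt_div_iff₀ hsy hsx] at h

/-- In a spherical triangle, with sides `a`, `b`, `c` and angles `α`, `β` adjacent to `c`, one has
`a cos β + b cos α < c`. Here the cosines of the angles are expressed by the sides, and the sides
by their half-differences. -/
theorem triangle_projection_aux {X Y Z : ℝ} (hX : 0 < X) (hY : 0 < Y) (hZ : 0 < Z)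
    (hs : X + Y + Z < Real.pi) :
    (Y + Z) * Real.sin (X + Z) * (Real.cos (X + Z) - Real.cos (Y + Z) * Real.cos (X + Y))
      + (X + Z) * Real.sin (Y + Z) * (Real.cos (Y + Z) - Real.cos (X + Z) * Real.cos (X + Y))
      < (X + Y) * Real.sin (Y + Z) * Real.sin (X + Z) * Real.sin (X + Y) := by
  have hsX := Real.sin_pos_of_pos_of_lt_pi hX (by linarith)
  have hsY := Real.sin_pos_of_pos_of_lt_pi hY (by linarith)
  have hsa := Real.sin_pos_of_pos_of_lt_pi (show 0 < Y + Z by linarith) (by linarith)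
  have hsb := Real.sin_pos_of_pos_of_lt_pi (show 0 < X + Z by linarith) (by linarith)
  have h1 := mul_cos_mul_sin_lt hX (show X < X + Z by linarith) (by linarith)
  have h2 := mul_cos_mul_sin_lt hY (show Y < Y + Z by linarith) (by linarith)
  have h3 := mul_pos (mul_pos hsY hsa) (sub_pos.mpr h1)
  have h4 := mul_pos (mul_pos hsX hsb) (sub_pos.mpr h2)
  -- The sides are a = Y + Z, b = X + Z, c = X + Y. The difference splits into two terms with
  -- positive weights, which compare t cot t at X with b and at Y with a.
  have key : (X + Y) * Real.sin (Y + Z) * Real.sin (X + Z) * Real.sin (X + Y)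
      - ((Y + Z) * Real.sin (X + Z) * (Real.cos (X + Z) - Real.cos (Y + Z) * Real.cos (X + Y))
      + (X + Z) * Real.sin (Y + Z) * (Real.cos (Y + Z) - Real.cos (X + Z) * Real.cos (X + Y)))
      = 2 * (Real.sin Y * Real.sin (Y + Z) *
          (X * Real.cos X * Real.sin (X + Z) - (X + Z) * Real.cos (X + Z) * Real.sin X)
        + Real.sin X * Real.sin (X + Z) *
          (Y * Real.cos Y * Real.sin (Y + Z) - (Y + Z) * Real.cos (Y + Z) * Real.sin Y)) := by
    have eX : Real.sin (X + Z) * Real.sin (X + Y) + Real.cos (X + Z) * Real.cos (X + Y)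
        - Real.cos (Y + Z) = 2 * Real.sin Y *
          (Real.cos X * Real.sin (X + Z) - Real.cos (X + Z) * Real.sin X) := by
      have e1 := Real.cos_sub (X + Z) (X + Y)
      have e2 := Real.sin_sub (X + Z) X
      rw [show X + Z - (X + Y) = Z - Y by ring, Real.cos_sub] at e1
      rw [show X + Z - X = Z by ring] at e2
      rw [Real.cos_add Y Z]
      linear_combination -e1 + 2 * Real.sin Y * e2
    have eY : Real.sin (Y + Z) * Real.sin (X + Y) + Real.cos (Y + Z) * Real.cos (X + Y)
        - Real.cos (X + Z) = 2 * Real.sin X *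
          (Real.cos Y * Real.sin (Y + Z) - Real.cos (Y + Z) * Real.sin Y) := by
      have e1 := Real.cos_sub (Y + Z) (X + Y)
      have e2 := Real.sin_sub (Y + Z) Y
      rw [show Y + Z - (X + Y) = Z - X by ring, Real.cos_sub] at e1
      rw [show Y + Z - Y = Z by ring] at e2
      rw [Real.cos_add X Z]
      linear_combination -e1 + 2 * Real.sin X * e2
    have eZ : Real.sin (X + Z) * (Real.cos (X + Z) - Real.cos (Y + Z) * Real.cos (X + Y))
        + Real.sin (Y + Z) * (Real.cos (Y + Z) - Real.cos (X + Z) * Real.cos (X + Y))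
        = 2 * Real.sin X * Real.sin Y * (Real.sin (Y + Z) * Real.cos (X + Z)
          + Real.cos (Y + Z) * Real.sin (X + Z)) := by
      have e1 := Real.cos_sub (Y + Z) (X + Z)
      rw [show Y + Z - (X + Z) = Y - X by ring, Real.cos_sub] at e1
      rw [Real.cos_add X Y]
      linear_combination (- (Real.sin (Y + Z) * Real.cos (X + Z)
          + Real.cos (Y + Z) * Real.sin (X + Z))) * e1
        - (Real.cos (X + Z) * Real.sin (X + Z)) * Real.sin_sq_add_cos_sq (Y + Z)
        - (Real.cos (Y + Z) * Real.sin (Y + Z)) * Real.sin_sq_add_cos_sq (X + Z)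
    linear_combination X * Real.sin (Y + Z) * eX + Y * Real.sin (X + Z) * eY - Z * eZ
  linarith

/-- Positivity of the Gram determinant says that cos c lies strictly between cos (a + b) and cos (a
- b). This gives the strict triangle inequalities and a perimeter below 2π, so the half-differences
of the sides are admissible. -/
theorem triangle_projection {a b c : ℝ} (ha : 0 < a) (ha' : a < Real.pi) (hb : 0 < b)
    (hb' : b < Real.pi) (hc : 0 < c) (hc' : c < Real.pi)
    (hdet : 0 < 1 + 2 * Real.cos a * Real.cos b * Real.cos c
      - Real.cos a ^ 2 - Real.cos b ^ 2 - Real.cos c ^ 2) :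
    a * Real.sin b * (Real.cos b - Real.cos a * Real.cos c)
      + b * Real.sin a * (Real.cos a - Real.cos b * Real.cos c)
      < c * Real.sin a * Real.sin b * Real.sin c := by
  have hsa := Real.sin_pos_of_pos_of_lt_pi ha ha'
  have hsb := Real.sin_pos_of_pos_of_lt_pi hb hb'
  have habs : |Real.cos c - Real.cos a * Real.cos b| < Real.sin a * Real.sin b := by
    refine abs_lt_of_sq_lt_sq ?_ (by positivity)
    rw [mul_pow, Real.sin_sq, Real.sin_sq]
    linarith
  obtain ⟨h1, h2⟩ := abs_lt.mp habs
  have h3 : Real.cos (a + b) < Real.cos c := by rw [Real.cos_add]; linarith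
  have h4 : Real.cos c < Real.cos |a - b| := by rw [Real.cos_abs, Real.cos_sub]; linarith
  have h5 : |a - b| < c := by
    by_contra! h
    exact absurd h4 (not_lt.mpr (Real.cos_le_cos_of_nonneg_of_le_pi hc.le
      (abs_le.mpr ⟨by linarith, by linarith⟩) h))
  have h6 : c < a + b := by
    by_contra! h
    exact absurd h3 (not_lt.mpr (Real.cos_le_cos_of_nonneg_of_le_pi (by linarith) hc'.le h))
  have h7 : a + b + c < 2 * Real.pi := by
    by_contra! h
    rw [← Real.cos_two_pi_sub (a + b)] at h3
    exact absurd h3 (not_lt.mpr (Real.cos_le_cos_of_nonneg_of_le_pi (by linarith) hc'.le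
      (by linarith)))
  obtain ⟨h8, h9⟩ := abs_lt.mp h5
  have := triangle_projection_aux (X := (b + c - a) / 2) (Y := (a + c - b) / 2)
    (Z := (a + b - c) / 2) (by linarith) (by linarith) (by linarith) (by linarith)
  rwa [show (a + c - b) / 2 + (a + b - c) / 2 = a by ring,
    show (b + c - a) / 2 + (a + b - c) / 2 = b by ring,
    show (b + c - a) / 2 + (a + c - b) / 2 = c by ring] at this

/-! ### Edge moments -/

/-- The component in the direction `u` of the vector of length `arccos ⟨x, y⟩` in the direction of
`x × y`. -/
noncomputable def edgeMoment (x y u : V3) : ℝ :=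
  Real.arccos (x ⬝ᵥ y) / Real.sin (Real.arccos (x ⬝ᵥ y)) * trip x y u

theorem edgeMoment_swap (x y u : V3) : edgeMoment x y u = -edgeMoment y x u := by
  unfold edgeMoment
  rw [dotProduct_comm y x, trip_rot y x u, trip_swap x u y]; ring

theorem trip_sq {x y z : V3} (hx : x ⬝ᵥ x = 1) (hy : y ⬝ᵥ y = 1) (hz : z ⬝ᵥ z = 1) :
    trip x y z ^ 2 = 1 + 2 * (y ⬝ᵥ z) * (z ⬝ᵥ x) * (x ⬝ᵥ y)
      - (y ⬝ᵥ z) ^ 2 - (z ⬝ᵥ x) ^ 2 - (x ⬝ᵥ y) ^ 2 := by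
  have h : trip x y z ^ 2 = (x ⬝ᵥ x) * (y ⬝ᵥ y) * (z ⬝ᵥ z)
      + 2 * (y ⬝ᵥ z) * (z ⬝ᵥ x) * (x ⬝ᵥ y)
      - (x ⬝ᵥ x) * (y ⬝ᵥ z) ^ 2 - (y ⬝ᵥ y) * (z ⬝ᵥ x) ^ 2 - (z ⬝ᵥ z) * (x ⬝ᵥ y) ^ 2 := by
    simp only [trip_eq, dot_eq]; ring
  rw [h, hx, hy, hz]; ring

theorem abs_dot_lt_one {x y z : V3} (hx : x ⬝ᵥ x = 1) (hy : y ⬝ᵥ y = 1) (h : trip x y z ≠ 0) :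
    -1 < x ⬝ᵥ y ∧ x ⬝ᵥ y < 1 := by
  have h1 : x ⨯₃ y ≠ 0 := by
    intro h2
    apply h
    rw [← dot_cross, h2, zero_dotProduct]
  have h2 := dot_self_pos h1
  rw [cross_dot_self, hx, hy] at h2
  exact abs_lt.mp ((sq_lt_one_iff_abs_lt_one _).mp (by linarith))

theorem arccos_mem {p : ℝ} (h1 : -1 < p) (h2 : p < 1) :
    0 < Real.arccos p ∧ Real.arccos p < Real.pi := by
  refine ⟨Real.arccos_pos.mpr h2, lt_of_le_of_ne (Real.arccos_le_pi p) fun h => ?_⟩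
  rw [Real.arccos_eq_pi] at h
  linarith

/-- By the cosine rule the sum equals sin c (c - a cos β - b cos α), where c is the side from `x` to
`y`. -/
theorem edgeMoment_sum_pos_cross {x y z : V3} (hx : x ⬝ᵥ x = 1) (hy : y ⬝ᵥ y = 1)
    (hz : z ⬝ᵥ z = 1) (h : 0 < trip x y z) :
    0 < edgeMoment x y (x ⨯₃ y) + edgeMoment y z (x ⨯₃ y) + edgeMoment z x (x ⨯₃ y) := by
  have hp := abs_dot_lt_one hx hy h.ne'
  have hq := abs_dot_lt_one hy hz (z := x) (by rw [← trip_rot]; exact h.ne')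
  have hr := abs_dot_lt_one hz hx (z := y) (by rw [trip_rot]; exact h.ne')
  have hc := arccos_mem hp.1 hp.2
  have ha := arccos_mem hq.1 hq.2
  have hb := arccos_mem hr.1 hr.2
  have hsa := Real.sin_pos_of_pos_of_lt_pi ha.1 ha.2
  have hsb := Real.sin_pos_of_pos_of_lt_pi hb.1 hb.2
  have hsc := Real.sin_pos_of_pos_of_lt_pi hc.1 hc.2
  have ec := Real.cos_arccos hp.1.le hp.2.le
  have ea := Real.cos_arccos hq.1.le hq.2.le
  have eb := Real.cos_arccos hr.1.le hr.2.le
  have t1 : trip x y (x ⨯₃ y) = 1 - (x ⬝ᵥ y) ^ 2 := by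
    rw [← dot_cross, cross_dot_self, hx, hy]; ring
  have t2 : trip y z (x ⨯₃ y) = (x ⬝ᵥ y) * (y ⬝ᵥ z) - z ⬝ᵥ x := by
    rw [← dot_cross, cross_dot_cross, hy, dotProduct_comm y x, dotProduct_comm z y]; ring
  have t3 : trip z x (x ⨯₃ y) = (z ⬝ᵥ x) * (x ⬝ᵥ y) - y ⬝ᵥ z := by
    rw [← dot_cross, cross_dot_cross, hx, dotProduct_comm z y]; ring
  have hdet : 0 < 1 + 2 * (y ⬝ᵥ z) * (z ⬝ᵥ x) * (x ⬝ᵥ y)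
      - (y ⬝ᵥ z) ^ 2 - (z ⬝ᵥ x) ^ 2 - (x ⬝ᵥ y) ^ 2 := by
    rw [← trip_sq hx hy hz]; positivity
  have key := triangle_projection ha.1 ha.2 hb.1 hb.2 hc.1 hc.2 (by rw [ea, eb, ec]; exact hdet)
  unfold edgeMoment
  rw [t1, t2, t3]
  set a := Real.arccos (y ⬝ᵥ z)
  set b := Real.arccos (z ⬝ᵥ x)
  set c := Real.arccos (x ⬝ᵥ y)
  rw [← ea, ← eb, ← ec, ← Real.sin_sq]
  have e : c / Real.sin c * Real.sin c ^ 2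
      + a / Real.sin a * (Real.cos c * Real.cos a - Real.cos b)
      + b / Real.sin b * (Real.cos b * Real.cos c - Real.cos a)
      = (c * Real.sin a * Real.sin b * Real.sin c
        - (a * Real.sin b * (Real.cos b - Real.cos a * Real.cos c)
        + b * Real.sin a * (Real.cos a - Real.cos b * Real.cos c)))
        / (Real.sin a * Real.sin b) := by
    field_simp
    ring
  rw [e]
  exact div_pos (by linarith) (by positivity)

/-- Expansion of `u` in the basis y × z, z × x, x × y, which is dual to `x`, `y`, `z` up to the
factor `trip x y z`. It reduces a general direction to the poles of the three sides. -/
theorem trip_mul_trip (x y z u a b : V3) : trip x y z * trip a b u =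
    (x ⬝ᵥ u) * trip a b (y ⨯₃ z) + (y ⬝ᵥ u) * trip a b (z ⨯₃ x)
      + (z ⬝ᵥ u) * trip a b (x ⨯₃ y) := by
  simp only [trip_eq, dot_eq, cross_apply]
  simp
  ring

/-- The sum of the edge moments of a positively oriented triangle has a positive component in each
direction in whose closed hemisphere the triangle lies. -/
theorem edgeMoment_sum_pos {x y z u : V3} (hx : x ⬝ᵥ x = 1) (hy : y ⬝ᵥ y = 1)
    (hz : z ⬝ᵥ z = 1) (h : 0 < trip x y z) (hux : 0 ≤ x ⬝ᵥ u) (huy : 0 ≤ y ⬝ᵥ u)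
    (huz : 0 ≤ z ⬝ᵥ u) (hu : 0 < y ⬝ᵥ u ∨ 0 < z ⬝ᵥ u) :
    0 < edgeMoment x y u + edgeMoment y z u + edgeMoment z x u := by
  have h1 := edgeMoment_sum_pos_cross hx hy hz h
  have h2 := edgeMoment_sum_pos_cross hy hz hx (by rw [← trip_rot]; exact h)
  have h3 := edgeMoment_sum_pos_cross hz hx hy (by rw [trip_rot]; exact h)
  have e : trip x y z * (edgeMoment x y u + edgeMoment y z u + edgeMoment z x u) =
      (x ⬝ᵥ u) * (edgeMoment y z (y ⨯₃ z) + edgeMoment z x (y ⨯₃ z) + edgeMoment x y (y ⨯₃ z))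
      + (y ⬝ᵥ u) * (edgeMoment z x (z ⨯₃ x) + edgeMoment x y (z ⨯₃ x) + edgeMoment y z (z ⨯₃ x))
      + (z ⬝ᵥ u) * (edgeMoment x y (x ⨯₃ y) + edgeMoment y z (x ⨯₃ y)
        + edgeMoment z x (x ⨯₃ y)) := by
    unfold edgeMoment
    linear_combination
      Real.arccos (x ⬝ᵥ y) / Real.sin (Real.arccos (x ⬝ᵥ y)) * trip_mul_trip x y z u x y
      + Real.arccos (y ⬝ᵥ z) / Real.sin (Real.arccos (y ⬝ᵥ z)) * trip_mul_trip x y z u y z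
      + Real.arccos (z ⬝ᵥ x) / Real.sin (Real.arccos (z ⬝ᵥ x)) * trip_mul_trip x y z u z x
  refine (pos_iff_pos_of_mul_pos ?_).mp h
  rw [e]
  rcases hu with hu | hu
  · have := mul_pos hu h3
    have := mul_nonneg hux h2.le
    have := mul_nonneg huz h1.le
    linarith
  · have := mul_pos hu h1
    have := mul_nonneg hux h2.le
    have := mul_nonneg huy h3.le
    linarith

/-- The triangle inequality on the unit sphere. -/
theorem arccos_sub_le {x y z : V3} (hx : x ⬝ᵥ x = 1) (hy : y ⬝ᵥ y = 1) (hz : z ⬝ᵥ z = 1) :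
    Real.arccos (y ⬝ᵥ z) ≤ Real.arccos (x ⬝ᵥ y) + Real.arccos (z ⬝ᵥ x) := by
  have hb : ∀ a b : V3, a ⬝ᵥ a = 1 → b ⬝ᵥ b = 1 → -1 ≤ a ⬝ᵥ b ∧ a ⬝ᵥ b ≤ 1 := by
    intro a b ha hb
    have h1 := cross_dot_self a b
    have h2 : 0 ≤ (a ⨯₃ b) ⬝ᵥ (a ⨯₃ b) := by
      rw [dot_eq]
      nlinarith [sq_nonneg ((a ⨯₃ b) 0), sq_nonneg ((a ⨯₃ b) 1), sq_nonneg ((a ⨯₃ b) 2)]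
    rw [ha, hb] at h1
    exact abs_le.mp ((sq_le_one_iff_abs_le_one _).mp (by linarith))
  have hp := hb x y hx hy
  have hq := hb y z hy hz
  have hr := hb z x hz hx
  have ec := Real.cos_arccos hp.1 hp.2
  have ea := Real.cos_arccos hq.1 hq.2
  have eb := Real.cos_arccos hr.1 hr.2
  have hdet := trip_sq hx hy hz
  rw [← ea, ← eb, ← ec] at hdet
  set a := Real.arccos (y ⬝ᵥ z)
  set b := Real.arccos (z ⬝ᵥ x)
  set c := Real.arccos (x ⬝ᵥ y)
  have hsb : 0 ≤ Real.sin b := Real.sin_nonneg_of_nonneg_of_le_pi (Real.arccos_nonneg _)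
    (Real.arccos_le_pi _)
  have hsc : 0 ≤ Real.sin c := Real.sin_nonneg_of_nonneg_of_le_pi (Real.arccos_nonneg _)
    (Real.arccos_le_pi _)
  have habs : |Real.cos a - Real.cos c * Real.cos b| ≤ Real.sin c * Real.sin b := by
    refine abs_le_of_sq_le_sq ?_ (by positivity)
    rw [mul_pow, Real.sin_sq, Real.sin_sq]
    nlinarith [sq_nonneg (trip x y z)]
  have h3 : Real.cos (c + b) ≤ Real.cos a := by
    rw [Real.cos_add]; linarith [(abs_le.mp habs).1]
  by_contra! h
  exact absurd h3 (not_le.mpr (Real.cos_lt_cos_of_nonneg_of_le_pi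
    (add_nonneg (Real.arccos_nonneg _) (Real.arccos_nonneg _)) (Real.arccos_le_pi _) h))

/-! ### Moving frames -/

/-- A moving frame: a point of the unit sphere, a unit tangent vector and the left normal. -/
structure Frame where
  /-- The point. -/
  x : V3
  /-- The tangent vector. -/
  t : V3
  /-- The normal vector. -/
  n : V3

namespace Frame

/-- The frame is orthonormal and positively oriented. -/
structure IsOrtho (F : Frame) : Prop where
  xx : F.x ⬝ᵥ F.x = 1
  tt : F.t ⬝ᵥ F.t = 1
  xt : F.x ⬝ᵥ F.t = 0
  cross : F.x ⨯₃ F.t = F.n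

/-- Transport of a frame by the arc length `a` along the great circle that it is tangent to. -/
noncomputable def advance (a : ℝ) (F : Frame) : Frame :=
  ⟨Real.cos a • F.x + Real.sin a • F.t, (-Real.sin a) • F.x + Real.cos a • F.t, F.n⟩

/-- Rotation of a frame to the left by the angle `b` about its point. -/
noncomputable def turn (b : ℝ) (F : Frame) : Frame :=
  ⟨F.x, Real.cos b • F.t + Real.sin b • F.n, (-Real.sin b) • F.t + Real.cos b • F.n⟩

variable {F : Frame}

theorem advance_advance (a b : ℝ) (F : Frame) : advance b (advance a F) = advance (a + b) F := by
  simp only [advance, Frame.mk.injEq, and_true, Real.cos_add, Real.sin_add]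
  constructor <;> module

theorem advance_zero (F : Frame) : advance 0 F = F := by simp [advance]

theorem turn_zero (F : Frame) : turn 0 F = F := by simp [turn]

namespace IsOrtho

theorem tx (h : F.IsOrtho) : F.t ⬝ᵥ F.x = 0 := by rw [dotProduct_comm, h.xt]

theorem xn (h : F.IsOrtho) : F.x ⬝ᵥ F.n = 0 := by
  rw [← h.cross]; exact trip_left_eq _ _

theorem tn (h : F.IsOrtho) : F.t ⬝ᵥ F.n = 0 := by
  rw [← h.cross]; exact trip_outer_eq _ _

theorem nn (h : F.IsOrtho) : F.n ⬝ᵥ F.n = 1 := by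
  rw [← h.cross, cross_dot_self, h.xx, h.tt, h.xt]; ring

theorem nx (h : F.IsOrtho) : F.n ⬝ᵥ F.x = 0 := by rw [dotProduct_comm, h.xn]

theorem nt (h : F.IsOrtho) : F.n ⬝ᵥ F.t = 0 := by rw [dotProduct_comm, h.tn]

theorem cross_nx (h : F.IsOrtho) : F.n ⨯₃ F.x = F.t := by
  have e : F.n ⨯₃ F.x = (F.x ⬝ᵥ F.x) • F.t - (F.x ⬝ᵥ F.t) • F.x := by
    rw [← h.cross]
    ext i; fin_cases i <;> simp [cross_apply, dot_eq] <;> ring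
  rw [e, h.xx, h.xt]; simp

theorem cross_nt (h : F.IsOrtho) : F.n ⨯₃ F.t = -F.x := by
  have e : F.n ⨯₃ F.t = (F.x ⬝ᵥ F.t) • F.t - (F.t ⬝ᵥ F.t) • F.x := by
    rw [← h.cross]
    ext i; fin_cases i <;> simp [cross_apply, dot_eq] <;> ring
  rw [e, h.tt, h.xt]; simp

theorem cross_tn (h : F.IsOrtho) : F.t ⨯₃ F.n = F.x := by
  rw [← cross_anticomm, h.cross_nt, neg_neg]

theorem advance (h : F.IsOrtho) (a : ℝ) : (advance a F).IsOrtho := by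
  have e := Real.sin_sq_add_cos_sq a
  constructor <;> simp only [Frame.advance, add_dotProduct, dotProduct_add, smul_dotProduct,
    dotProduct_smul, h.xx, h.tt, h.xt, h.tx, smul_eq_mul]
  · linear_combination e
  · linear_combination e
  · ring
  · simp only [map_add, map_smul, LinearMap.add_apply, LinearMap.smul_apply, cross_self, h.cross,
      ← cross_anticomm F.x F.t]
    rw [show (-Real.sin a) • (Real.cos a • (0 : V3) + Real.sin a • (-F.n))
      + Real.cos a • (Real.cos a • F.n + Real.sin a • (0 : V3))
      = (Real.sin a ^ 2 + Real.cos a ^ 2) • F.n by module, e, one_smul]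

theorem turn (h : F.IsOrtho) (b : ℝ) : (turn b F).IsOrtho := by
  have e := Real.sin_sq_add_cos_sq b
  constructor <;> simp only [Frame.turn, add_dotProduct, dotProduct_add, smul_dotProduct,
    dotProduct_smul, h.xx, h.tt, h.xt, h.tn, h.nt, h.nn, h.xn, smul_eq_mul]
  · linear_combination e
  · ring
  · simp only [map_add, map_smul, h.cross, ← cross_anticomm F.n F.x, h.cross_nx]
    module

theorem trip_advance (h : F.IsOrtho) (a : ℝ) (u : V3) :
    trip F.x (Frame.advance a F).x u = Real.sin a * (F.n ⬝ᵥ u) := by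
  simp only [Frame.advance]
  rw [trip_comb_mid, trip_left_eq, ← dot_cross, h.cross]; ring

theorem dot_advance (h : F.IsOrtho) (a : ℝ) :
    F.x ⬝ᵥ (Frame.advance a F).x = Real.cos a := by
  simp [Frame.advance, h.xx, h.xt]

theorem dot_advance_turn_advance (h : F.IsOrtho) (a b c : ℝ) :
    F.x ⬝ᵥ (Frame.advance c (Frame.turn b (Frame.advance a F))).x =
      Real.cos a * Real.cos c - Real.cos b * (Real.sin a * Real.sin c) := by
  simp [Frame.advance, Frame.turn, h.xx, h.xt, h.xn]; ring

theorem trip_advance_turn_advance (h : F.IsOrtho) (a b c : ℝ) :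
    trip F.x (Frame.advance a F).x (Frame.advance c (Frame.turn b (Frame.advance a F))).x =
      Real.sin a * (Real.sin c * Real.sin b) := by
  rw [h.trip_advance]
  simp [Frame.advance, Frame.turn, h.nx, h.nt, h.nn]

end IsOrtho

end Frame

/-! ### The model chain as a function of the scale -/

section Chain

variable (ℓ τ : ℕ → ℝ)

/-- The frames along the chain on the unit sphere whose edges have the lengths `k * ℓ j` and which
turns left by `τ j` at its vertex `j`. -/
noncomputable def frame (k : ℝ) : ℕ → Frame
  | 0 => ⟨![1, 0, 0], ![0, 1, 0], ![0, 0, 1]⟩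
  | j + 1 => Frame.turn (τ (j + 1)) (Frame.advance (k * ℓ j) (frame k j))

/-- The vertices of the chain. -/
noncomputable def pt (k : ℝ) (j : ℕ) : V3 := (frame ℓ τ k j).x

/-- The angular velocity of the frame `j` when the scale `k` changes with unit speed. -/
noncomputable def spin (k : ℝ) (j : ℕ) : V3 :=
  ∑ m ∈ Finset.range j, ℓ m • (frame ℓ τ k m).n

variable {ℓ τ} {k : ℝ}

theorem frame_isOrtho (k : ℝ) (j : ℕ) : (frame ℓ τ k j).IsOrtho := by
  induction j with
  | zero =>
    constructor <;> simp [frame, cross_apply]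
  | succ j ih => exact (ih.advance _).turn _

theorem pt_unit (k : ℝ) (j : ℕ) : pt ℓ τ k j ⬝ᵥ pt ℓ τ k j = 1 := (frame_isOrtho k j).xx

theorem pt_succ (k : ℝ) (j : ℕ) :
    pt ℓ τ k (j + 1) = (Frame.advance (k * ℓ j) (frame ℓ τ k j)).x := rfl

theorem frame_straight {i j : ℕ} (hij : i ≤ j) (h : ∀ m, i < m → m ≤ j → τ m = 0) :
    frame ℓ τ k j = Frame.advance
      (k * (∑ m ∈ Finset.range j, ℓ m - ∑ m ∈ Finset.range i, ℓ m)) (frame ℓ τ k i) := by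
  induction j, hij using Nat.le_induction with
  | base => rw [sub_self, mul_zero, Frame.advance_zero]
  | succ j hj ih =>
    rw [frame, h (j + 1) (by omega) le_rfl, Frame.turn_zero,
      ih fun m h1 h2 => h m h1 (by omega), Frame.advance_advance, Finset.sum_range_succ]
    congr 1; ring

theorem pt_straight {i j : ℕ} (hij : i < j) (h : ∀ m, i < m → m < j → τ m = 0) :
    pt ℓ τ k j = (Frame.advance
      (k * (∑ m ∈ Finset.range j, ℓ m - ∑ m ∈ Finset.range i, ℓ m)) (frame ℓ τ k i)).x := by
  obtain ⟨j, rfl⟩ : ∃ j', j = j' + 1 := ⟨j - 1, by omega⟩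
  rw [pt_succ, frame_straight (show i ≤ j by omega) fun m h1 h2 => h m h1 (by omega),
    Frame.advance_advance, Finset.sum_range_succ]
  congr 2; ring

theorem trip_consecutive (k : ℝ) (j : ℕ) :
    trip (pt ℓ τ k j) (pt ℓ τ k (j + 1)) (pt ℓ τ k (j + 2)) =
      Real.sin (k * ℓ j) * (Real.sin (k * ℓ (j + 1)) * Real.sin (τ (j + 1))) :=
  (frame_isOrtho k j).trip_advance_turn_advance _ _ _

/-- A straight run lies on one great circle at every scale. Hence such a vanishing triple product
cannot become negative when the scale changes. -/
theorem trip_straight {i j l : ℕ} (hij : i < j) (hjl : j < l)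
    (h : ∀ m, i < m → m < l → τ m = 0) (k : ℝ) :
    trip (pt ℓ τ k i) (pt ℓ τ k j) (pt ℓ τ k l) = 0 := by
  rw [pt_straight hij fun m h1 h2 => h m h1 (by omega), pt_straight (hij.trans hjl) h]
  rw [pt, (frame_isOrtho k i).trip_advance]
  simp [Frame.advance, (frame_isOrtho k i).nx, (frame_isOrtho k i).nt]

/-- Lengthening edge j rotates everything after it about the normal of frame j with speed `ℓ j`,
while the turns are constant. So the angular velocities add up along the chain. -/
theorem hasDerivAt_frame (k : ℝ) (j : ℕ) :
    HasDerivAt (fun k => (frame ℓ τ k j).x) (spin ℓ τ k j ⨯₃ (frame ℓ τ k j).x) k ∧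
    HasDerivAt (fun k => (frame ℓ τ k j).t) (spin ℓ τ k j ⨯₃ (frame ℓ τ k j).t) k ∧
    HasDerivAt (fun k => (frame ℓ τ k j).n) (spin ℓ τ k j ⨯₃ (frame ℓ τ k j).n) k := by
  induction j with
  | zero => simp [frame, spin, hasDerivAt_const]
  | succ j ih =>
    obtain ⟨hx, ht, hn⟩ := ih
    have ho := frame_isOrtho (ℓ := ℓ) (τ := τ) k j
    have hl : HasDerivAt (fun k => k * ℓ j) (ℓ j) k := by
      simpa using (hasDerivAt_id k).mul_const (ℓ j)
    have hc := hl.cos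
    have hs := hl.sin
    have e : spin ℓ τ k (j + 1) = spin ℓ τ k j + ℓ j • (frame ℓ τ k j).n := by
      rw [spin, Finset.sum_range_succ]; rfl
    have hx' := (hc.smul hx).add (hs.smul ht)
    have ht' := (hs.neg.smul hx).add (hc.smul ht)
    refine ⟨?_, ?_, ?_⟩
    · refine hx'.congr_deriv ?_
      simp only [frame, Frame.turn, Frame.advance, e, map_add, map_smul, LinearMap.add_apply,
        LinearMap.smul_apply, ho.cross_nx, ho.cross_nt]
      module
    · refine ((ht'.const_smul (Real.cos (τ (j + 1)))).add
        (hn.const_smul (Real.sin (τ (j + 1))))).congr_deriv ?_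
      simp only [frame, Frame.turn, Frame.advance, e, map_add, map_smul, LinearMap.add_apply,
        LinearMap.smul_apply, ho.cross_nx, ho.cross_nt, cross_self,
        Pi.neg_apply]
      module
    · refine ((ht'.const_smul (-Real.sin (τ (j + 1)))).add
        (hn.const_smul (Real.cos (τ (j + 1))))).congr_deriv ?_
      simp only [frame, Frame.turn, Frame.advance, e, map_add, map_smul, LinearMap.add_apply,
        LinearMap.smul_apply, ho.cross_nx, ho.cross_nt, cross_self,
        Pi.neg_apply]
      module

theorem continuous_pt (j : ℕ) : Continuous fun k => pt ℓ τ k j :=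
  continuous_iff_continuousAt.mpr fun k => (hasDerivAt_frame k j).1.continuousAt

theorem continuous_trip_pt (i j l : ℕ) :
    Continuous fun k => trip (pt ℓ τ k i) (pt ℓ τ k j) (pt ℓ τ k l) := by
  have h : ∀ j c, Continuous fun k => pt ℓ τ k j c := fun j c =>
    (continuous_apply c).comp (continuous_pt j)
  simp only [trip_eq]
  have := h i
  have := h j
  have := h l
  fun_prop

/-- The rotation common to both points does not change their inner product; only the spin gained
between `p` and `q` counts. -/
theorem hasDerivAt_dot_pt {p q : ℕ} (hpq : p ≤ q) (k : ℝ) :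
    HasDerivAt (fun k => pt ℓ τ k p ⬝ᵥ pt ℓ τ k q)
      (∑ m ∈ Finset.Ico p q,
        ℓ m * ((frame ℓ τ k m).n ⬝ᵥ (pt ℓ τ k q ⨯₃ pt ℓ τ k p))) k := by
  have hd : ∀ j c, HasDerivAt (fun k => pt ℓ τ k j c) ((spin ℓ τ k j ⨯₃ pt ℓ τ k j) c) k :=
    fun j c => hasDerivAt_pi.mp (hasDerivAt_frame k j).1 c
  have h := (((hd p 0).mul (hd q 0)).add ((hd p 1).mul (hd q 1))).add ((hd p 2).mul (hd q 2))
  have e : (fun k => pt ℓ τ k p ⬝ᵥ pt ℓ τ k q) = fun k => pt ℓ τ k p 0 * pt ℓ τ k q 0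
      + pt ℓ τ k p 1 * pt ℓ τ k q 1 + pt ℓ τ k p 2 * pt ℓ τ k q 2 := by
    funext k; rw [dot_eq]
  rw [e]
  refine h.congr_deriv ?_
  have e2 : ∑ m ∈ Finset.Ico p q, ℓ m * ((frame ℓ τ k m).n ⬝ᵥ (pt ℓ τ k q ⨯₃ pt ℓ τ k p))
      = (spin ℓ τ k q - spin ℓ τ k p) ⬝ᵥ (pt ℓ τ k q ⨯₃ pt ℓ τ k p) := by
    rw [spin, spin, ← Finset.sum_Ico_eq_sub _ hpq, sum_dotProduct]
    simp only [smul_dotProduct, smul_eq_mul]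
  rw [e2]
  change _ = trip _ _ _
  simp only [trip_eq, cross_apply, Pi.sub_apply]
  simp
  ring

end Chain

/-! ### Weakly convex sequences and their coplanar triples -/

/-- The triple products of the vectors `x p, …, x q` are nonnegative for increasing triples. -/
def OrderedConvex (x : ℕ → V3) (p q : ℕ) : Prop :=
  ∀ i j l, p ≤ i → i < j → j < l → l ≤ q → 0 ≤ trip (x i) (x j) (x l)

theorem OrderedConvex.mono {x : ℕ → V3} {p q p' q' : ℕ} (h : OrderedConvex x p q) (hp : p ≤ p')
    (hq : q' ≤ q) : OrderedConvex x p' q' := fun i j l h1 h2 h3 h4 =>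
  h i j l (hp.trans h1) h2 h3 (h4.trans hq)

theorem cross_ne_zero_of_trip_ne_zero {a b c : V3} (h : trip a b c ≠ 0) :
    a ⨯₃ b ≠ 0 ∧ a ⨯₃ c ≠ 0 ∧ b ⨯₃ c ≠ 0 := by
  refine ⟨fun h1 => h ?_, fun h1 => h ?_, fun h1 => h ?_⟩
  · rw [← dot_cross, h1, zero_dotProduct]
  · rw [trip_swap, ← dot_cross, h1, zero_dotProduct, neg_zero]
  · rw [trip, h1, dotProduct_zero]

theorem trip_eq_zero_of_orthogonal {w a b c : V3} (hw : w ≠ 0) (ha : w ⬝ᵥ a = 0)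
    (hb : w ⬝ᵥ b = 0) (hc : w ⬝ᵥ c = 0) : trip a b c = 0 := by
  have h := dot_self_mul_trip hb hc a
  rw [ha, mul_zero] at h
  exact (mul_eq_zero.mp h).resolve_left (dot_self_pos hw).ne'

theorem trip_swap_left (a b c : V3) : trip b a c = -trip a b c := by simp only [trip_eq]; ring

theorem smul_cross_self (α : ℝ) (a : V3) : a ⨯₃ (α • a) = 0 := by
  rw [map_smul, cross_self, smul_zero]

/-- The vectors in the opposite order, with a sign that preserves triple products. -/
def reflect (x : ℕ → V3) (p q : ℕ) (m : ℕ) : V3 := -x (p + q - m)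

theorem trip_reflect (x : ℕ → V3) (p q i j l : ℕ) :
    trip (reflect x p q i) (reflect x p q j) (reflect x p q l) =
      trip (x (p + q - l)) (x (p + q - j)) (x (p + q - i)) := by
  simp only [reflect, trip_eq, Pi.neg_apply]; ring

theorem dot_reflect (x : ℕ → V3) (p q i j : ℕ) :
    reflect x p q i ⬝ᵥ reflect x p q j = x (p + q - i) ⬝ᵥ x (p + q - j) := by
  simp [reflect]

theorem OrderedConvex.reflect {x : ℕ → V3} {p q : ℕ} (h : OrderedConvex x p q) :
    OrderedConvex (reflect x p q) p q := fun i j l h1 h2 h3 h4 => by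
  rw [trip_reflect]
  exact h _ _ _ (by omega) (by omega) (by omega) (by omega)

section Strict

variable {x : ℕ → V3} {p q : ℕ} (hunit : ∀ i, x i ⬝ᵥ x i = 1)
  (hstep : ∀ i, p ≤ i → i < q → x i ⨯₃ x (i + 1) ≠ 0) (hc : OrderedConvex x p q)
  (hA : 0 < trip (x p) (x (p + 1)) (x q)) (hB : 0 < trip (x p) (x (q - 1)) (x q))

include hunit hc hA hB in
-- Were `x i` = α `x p` + β `x q`, comparison with the two vertices next to the ends would force
-- both signs on α and on β, so `x i` would vanish.
theorem trip_ends_pos {i : ℕ} (hi : p < i) (hiq : i < q) : 0 < trip (x p) (x i) (x q) := by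
  refine lt_of_le_of_ne (hc p i q le_rfl hi hiq le_rfl) fun h => ?_
  have h1 : i ≠ p + 1 := by rintro rfl; linarith
  have h2 : i ≠ q - 1 := by rintro rfl; linarith
  obtain ⟨α, β, hab⟩ := exists_comb_of_trip_eq_zero (cross_ne_zero_of_trip_ne_zero hA.ne').2.1
    (show trip (x p) (x q) (x i) = 0 by rw [trip_swap, ← h, neg_zero])
  have e1 := hc p (p + 1) i le_rfl (by omega) (by omega) (by omega)
  have e2 := hc p i (q - 1) le_rfl (by omega) (by omega) (by omega)
  have e3 := hc (p + 1) i q (by omega) (by omega) (by omega) le_rfl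
  have e4 := hc i (q - 1) q (by omega) (by omega) (by omega) le_rfl
  rw [hab] at e1 e2 e3 e4
  rw [trip_comb_right, trip_outer_eq] at e1
  rw [trip_comb_mid, trip_left_eq, trip_swap (x p) (x q)] at e2
  rw [trip_comb_mid, trip_right_eq, trip_swap_left] at e3
  rw [trip_comb_left, trip_outer_eq] at e4
  have hβ : β = 0 := le_antisymm (by nlinarith) (by nlinarith)
  have hα : α = 0 := le_antisymm (by nlinarith) (by nlinarith)
  have := hunit i
  rw [hab, hα, hβ] at this
  simp at this

include hunit hstep hc hA hB in
-- Write `x j` = α `x p` + β `x i`. Then β > 0 and α < 0, so any vertex between `p` and `j` that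
-- left the plane would give triple products of opposite signs. The case α = 0 would put `x (i + 1)`
-- on the line of `x i`.
theorem trip_first_eq_zero {i j : ℕ} (hi : p < i) (hij : i < j) (hjq : j < q)
    (hz : trip (x p) (x i) (x j) = 0) {m : ℕ} (hpm : p ≤ m) (hmj : m ≤ j) :
    trip (x p) (x i) (x m) = 0 := by
  have hi0 := trip_ends_pos hunit hc hA hB hi (hij.trans hjq)
  have hj0 := trip_ends_pos hunit hc hA hB (hi.trans hij) hjq
  obtain ⟨α, β, hab⟩ := exists_comb_of_trip_eq_zero (cross_ne_zero_of_trip_ne_zero hi0.ne').1 hz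
  have hβ : 0 < β := by
    rw [hab, trip_comb_mid, trip_left_eq] at hj0
    exact (pos_iff_pos_of_mul_pos (by linarith)).mpr hi0
  have hα : α ≤ 0 := by
    have h := hc i j q hi.le hij hjq le_rfl
    rw [hab, trip_comb_mid, trip_left_eq, trip_swap_left] at h
    nlinarith
  have hmid : ∀ m, i < m → m < j → trip (x p) (x i) (x m) = 0 := by
    intro m h1 h2
    have e1 := hc p i m le_rfl hi h1 (by omega)
    have e2 := hc p m j le_rfl (by omega) h2 (by omega)
    rw [hab, trip_comb_right, trip_outer_eq, trip_swap] at e2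
    nlinarith
  have hα0 : α ≠ 0 := by
    rintro rfl
    rw [zero_smul, zero_add] at hab
    rcases eq_or_lt_of_le (show i + 1 ≤ j from hij) with h1 | h1
    · exact hstep i hi.le (by omega) (by rw [h1, hab, smul_cross_self])
    · have e1 := hc i (i + 1) q hi.le (by omega) (by omega) le_rfl
      have e2 := hc (i + 1) j q (by omega) h1 hjq le_rfl
      have e3 : trip (x (i + 1)) (x j) (x q) = β * trip (x (i + 1)) (x i) (x q) := by
        rw [hab]; simp only [trip_eq, Pi.smul_apply, smul_eq_mul]; ring
      rw [e3, trip_swap_left] at e2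
      obtain ⟨α', β', hab'⟩ := exists_comb_of_trip_eq_zero
        (cross_ne_zero_of_trip_ne_zero hi0.ne').1 (hmid (i + 1) (by omega) h1)
      have e4 : trip (x i) (x (i + 1)) (x q) = 0 := by nlinarith
      rw [hab', trip_comb_mid, trip_left_eq, trip_swap_left] at e4
      have hα' : α' = 0 := by
        have : α' * trip (x p) (x i) (x q) = 0 := by linarith
        exact (mul_eq_zero.mp this).resolve_right hi0.ne'
      rw [hα', zero_smul, zero_add] at hab'
      exact hstep i hi.le (by omega) (by rw [hab', smul_cross_self])
  rcases lt_trichotomy m i with h | rfl | h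
  · rcases eq_or_lt_of_le hpm with rfl | hpm
    · exact trip_outer_eq _ _
    have e1 := hc p m i le_rfl hpm h (by omega)
    have e2 := hc m i j hpm.le h hij hjq.le
    rw [hab, trip_comb_right, trip_right_eq, ← trip_rot] at e2
    have hα' : α < 0 := lt_of_le_of_ne hα hα0
    rw [trip_swap]
    nlinarith
  · exact trip_right_eq _ _
  · rcases eq_or_lt_of_le hmj with rfl | hmj
    · exact hz
    · exact hmid m h hmj

include hunit hstep hc hA hB in
/-- If an ordered convex sequence has strict corners at both ends, the triples on a plane through
the origin come from runs that are contained in this plane. -/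
theorem exists_orthogonal_of_trip_eq_zero {i j l : ℕ} (hpi : p ≤ i) (hij : i < j) (hjl : j < l)
    (hlq : l ≤ q) (hz : trip (x i) (x j) (x l) = 0) :
    ∃ w : V3, w ≠ 0 ∧ ∀ m, i ≤ m → m ≤ l → w ⬝ᵥ x m = 0 := by
  have hfirst : ∀ {i j : ℕ}, p < i → i < j → j < q → trip (x p) (x i) (x j) = 0 →
      ∃ w : V3, w ≠ 0 ∧ ∀ m, p ≤ m → m ≤ j → w ⬝ᵥ x m = 0 := by
    intro i j hi hij hjq hz
    refine ⟨x p ⨯₃ x i, (cross_ne_zero_of_trip_ne_zero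
      (trip_ends_pos hunit hc hA hB hi (hij.trans hjq)).ne').1, fun m h1 h2 => ?_⟩
    rw [dot_cross]
    exact trip_first_eq_zero hunit hstep hc hA hB hi hij hjq hz h1 h2
  rcases eq_or_lt_of_le hlq with rfl | hlq
  · rcases eq_or_lt_of_le hpi with rfl | hpi
    · exact absurd hz (trip_ends_pos hunit hc hA hB hij hjl).ne'
    · have hp : p + l - (p + 1) = l - 1 := by omega
      have hq : p + l - (l - 1) = p + 1 := by omega
      have hz' : trip (reflect x p l p) (reflect x p l (p + l - j)) (reflect x p l (p + l - i))
          = 0 := by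
        rw [trip_reflect, ← hz]; congr 2 <;> omega
      have hu : ∀ i, reflect x p l i ⬝ᵥ reflect x p l i = 1 := fun i => by
        rw [dot_reflect, hunit]
      have hA' : 0 < trip (reflect x p l p) (reflect x p l (p + 1)) (reflect x p l l) := by
        rw [trip_reflect, hp, Nat.add_sub_cancel, Nat.add_sub_cancel_left]; exact hB
      have hB' : 0 < trip (reflect x p l p) (reflect x p l (l - 1)) (reflect x p l l) := by
        rw [trip_reflect, hq, Nat.add_sub_cancel, Nat.add_sub_cancel_left]; exact hA
      have hs : ∀ i, p ≤ i → i < l → reflect x p l i ⨯₃ reflect x p l (i + 1) ≠ 0 := by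
        intro i h1 h2 h3
        refine hstep (p + l - (i + 1)) (by omega) (by omega) ?_
        rw [← cross_anticomm, neg_eq_zero, show p + l - (i + 1) + 1 = p + l - i by omega]
        simpa [reflect] using h3
      refine ⟨reflect x p l p ⨯₃ reflect x p l (p + l - j), (cross_ne_zero_of_trip_ne_zero
        (trip_ends_pos hu hc.reflect hA' hB' (by omega) (by omega)).ne').1, fun m h1 h2 => ?_⟩
      have := trip_first_eq_zero hu hs hc.reflect hA' hB' (i := p + l - j) (j := p + l - i)
        (by omega) (by omega) (by omega) hz' (m := p + l - m) (by omega) (by omega)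
      rw [← dot_cross, reflect, reflect, reflect, dotProduct_neg, neg_eq_zero,
        show p + l - (p + l - m) = m by omega] at this
      exact this
  · rcases eq_or_lt_of_le hpi with rfl | hpi
    · exact hfirst hij hjl hlq hz
    -- If the plane does not contain `x p`, then `x p` fixes the signs of the coefficients of `x j`
    -- in `x i` and `x l`: both are nonnegative. If one vanished, two consecutive vertices would be
    -- parallel. Once both are positive, the sign argument applies to the vertices between `i` and
    -- `l`.
    · by_cases h0 : trip (x p) (x i) (x l) = 0
      · obtain ⟨w, hw, h⟩ := hfirst hpi (hij.trans hjl) hlq h0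
        exact ⟨w, hw, fun m h1 h2 => h m (by omega) h2⟩
      have h1 : 0 < trip (x p) (x i) (x l) :=
        lt_of_le_of_ne (hc _ _ _ le_rfl hpi (by omega) hlq.le) (Ne.symm h0)
      have hil := (cross_ne_zero_of_trip_ne_zero h0).2.2
      obtain ⟨α, β, hab⟩ := exists_comb_of_trip_eq_zero hil
        (show trip (x i) (x l) (x j) = 0 by rw [trip_swap, hz, neg_zero])
      have hβ : 0 ≤ β := by
        have e := hc p i j le_rfl hpi hij (by omega)
        rw [hab, trip_comb_right, trip_right_eq] at e
        nlinarith
      have hα : 0 ≤ α := by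
        have e := hc p j l le_rfl (by omega) hjl hlq.le
        rw [hab, trip_comb_mid, trip_right_eq] at e
        nlinarith
      have hα0 : α ≠ 0 := by
        rintro rfl
        rw [zero_smul, zero_add] at hab
        rcases eq_or_lt_of_le (show j + 1 ≤ l from hjl) with h2 | h2
        · exact hstep j (by omega) (by omega)
            (by rw [h2, hab, ← cross_anticomm, smul_cross_self, neg_zero])
        have hβ' : β ≠ 0 := by
          rintro rfl
          have := hunit j
          rw [hab] at this
          simp at this
        have hβ' : 0 < β := lt_of_le_of_ne hβ (Ne.symm hβ')
        have e1 := hc i j (j + 1) hpi.le hij (by omega) (by omega)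
        have e2 := hc p j (j + 1) le_rfl (by omega) (by omega) (by omega)
        have e3 := hc i (j + 1) l hpi.le (by omega) h2 hlq.le
        have e4 := hc p (j + 1) l le_rfl (by omega) h2 hlq.le
        have e5 : ∀ a b : V3, trip a (x j) b = -(β * trip a b (x l)) := fun a b => by
          rw [hab]; simp only [trip_eq, Pi.smul_apply, smul_eq_mul]; ring
        rw [e5] at e1 e2
        obtain ⟨α', β', hab'⟩ := exists_comb_of_trip_eq_zero hil
          (show trip (x i) (x l) (x (j + 1)) = 0 by rw [trip_swap]; nlinarith)
        have e6 : trip (x p) (x (j + 1)) (x l) = 0 := by nlinarith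
        rw [hab', trip_comb_mid, trip_right_eq, mul_zero, add_zero] at e6
        rw [(mul_eq_zero.mp e6).resolve_right h0, zero_smul, zero_add] at hab'
        refine hstep j (by omega) (by omega) ?_
        rw [hab, hab']
        simp
      have hβ0 : β ≠ 0 := by
        rintro rfl
        rw [zero_smul, add_zero] at hab
        rcases eq_or_lt_of_le (show i + 1 ≤ j from hij) with h2 | h2
        · exact hstep i (by omega) (by omega) (by rw [h2, hab, smul_cross_self])
        have hα' : 0 < α := lt_of_le_of_ne hα (Ne.symm hα0)
        have e1 := hc (i + 1) j l (by omega) h2 hjl hlq.le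
        have e2 := hc p (i + 1) j le_rfl (by omega) h2 (by omega)
        have e3 := hc i (i + 1) l hpi.le (by omega) (by omega) hlq.le
        have e4 := hc p i (i + 1) le_rfl hpi (by omega) (by omega)
        have e5 : trip (x (i + 1)) (x j) (x l) = -(α * trip (x i) (x (i + 1)) (x l)) := by
          rw [hab]; simp only [trip_eq, Pi.smul_apply, smul_eq_mul]; ring
        have e6 : trip (x p) (x (i + 1)) (x j) = -(α * trip (x p) (x i) (x (i + 1))) := by
          rw [hab]; simp only [trip_eq, Pi.smul_apply, smul_eq_mul]; ring
        rw [e5] at e1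
        rw [e6] at e2
        obtain ⟨α', β', hab'⟩ := exists_comb_of_trip_eq_zero hil
          (show trip (x i) (x l) (x (i + 1)) = 0 by rw [trip_swap]; nlinarith)
        have e6 : trip (x p) (x i) (x (i + 1)) = 0 := by nlinarith
        rw [hab', trip_comb_right, trip_right_eq, mul_zero, zero_add] at e6
        rw [(mul_eq_zero.mp e6).resolve_right h0, zero_smul, add_zero] at hab'
        exact hstep i (by omega) (by omega) (by rw [hab', smul_cross_self])
      have hα' : 0 < α := lt_of_le_of_ne hα (Ne.symm hα0)
      have hβ' : 0 < β := lt_of_le_of_ne hβ (Ne.symm hβ0)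
      refine ⟨x i ⨯₃ x l, hil, fun m h2 h3 => ?_⟩
      rw [dot_cross]
      rcases eq_or_lt_of_le h2 with rfl | h2
      · exact trip_outer_eq _ _
      rcases eq_or_lt_of_le h3 with rfl | h3
      · exact trip_right_eq _ _
      have e0 := hc i m l hpi.le h2 h3 hlq.le
      rw [trip_swap]
      rcases lt_trichotomy m j with h4 | rfl | h4
      · have e1 := hc m j l (by omega) h4 hjl hlq.le
        rw [hab, trip_comb_mid, trip_right_eq, trip_swap_left] at e1
        nlinarith
      · rw [hz, neg_zero]
      · have e1 := hc i j m hpi.le hij h4 (by omega)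
        rw [hab, trip_comb_mid, trip_left_eq, trip_swap] at e1
        nlinarith

end Strict

/-- If the first corner of an ordered convex polygon is straight, its first vertex lies between
its two neighbours. -/
theorem arccos_dot_eq_add {x : ℕ → V3} {p q : ℕ} (hunit : ∀ i, x i ⬝ᵥ x i = 1)
    (hstep : x p ⨯₃ x (p + 1) ≠ 0) (hc : OrderedConvex x p q)
    (hA : trip (x p) (x (p + 1)) (x q) = 0)
    (hex : ∃ i, p + 1 < i ∧ i < q ∧ 0 < trip (x p) (x (p + 1)) (x i)) :
    Real.arccos (x (p + 1) ⬝ᵥ x q) =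
      Real.arccos (x p ⬝ᵥ x (p + 1)) + Real.arccos (x p ⬝ᵥ x q) := by
  obtain ⟨i, hi1, hi2, hi⟩ := hex
  obtain ⟨α, β, hab⟩ := exists_comb_of_trip_eq_zero hstep hA
  have hβ : β ≤ 0 := by
    have e := hc p i q le_rfl (by omega) hi2 le_rfl
    rw [hab, trip_comb_right, trip_outer_eq, trip_swap] at e
    nlinarith
  have hα : 0 ≤ α := by
    have e := hc (p + 1) i q (by omega) hi1 hi2 le_rfl
    rw [hab, trip_comb_right, trip_outer_eq, ← trip_rot] at e
    nlinarith
  have hlt := abs_dot_lt_one (hunit p) (hunit (p + 1)) hi.ne'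
  have hq := hunit q
  have e1 : x p ⬝ᵥ x q = α + β * (x p ⬝ᵥ x (p + 1)) := by
    rw [hab, dotProduct_add, dotProduct_smul, dotProduct_smul, hunit]; simp
  have e2 : x (p + 1) ⬝ᵥ x q = α * (x p ⬝ᵥ x (p + 1)) + β := by
    rw [hab, dotProduct_add, dotProduct_smul, dotProduct_smul, hunit,
      dotProduct_comm (x (p + 1)) (x p)]; simp
  have e3 : α ^ 2 + β ^ 2 + 2 * α * β * (x p ⬝ᵥ x (p + 1)) = 1 := by
    have : x q ⬝ᵥ x q = α * (x p ⬝ᵥ x q) + β * (x (p + 1) ⬝ᵥ x q) := by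
      nth_rewrite 1 [hab]
      simp
    rw [hq, e1, e2] at this
    linear_combination -this
  set c := x p ⬝ᵥ x (p + 1) with hcdef
  have ha := arccos_mem hlt.1 hlt.2
  have hsa := Real.sin_pos_of_pos_of_lt_pi ha.1 ha.2
  have hca := Real.cos_arccos hlt.1.le hlt.2.le
  set a := Real.arccos c
  have hsq := Real.sin_sq_add_cos_sq a
  rw [hca] at hsq
  have e4 : (x p ⬝ᵥ x q) ^ 2 + (β * Real.sin a) ^ 2 = 1 := by
    rw [e1]; linear_combination β ^ 2 * hsq + e3
  have hb1 : -1 ≤ x p ⬝ᵥ x q ∧ x p ⬝ᵥ x q ≤ 1 :=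
    abs_le.mp ((sq_le_one_iff_abs_le_one _).mp (by nlinarith [sq_nonneg (β * Real.sin a)]))
  have hcd := Real.cos_arccos hb1.1 hb1.2
  have hsd : Real.sin (Real.arccos (x p ⬝ᵥ x q)) = -(β * Real.sin a) := by
    rw [Real.sin_arccos, show 1 - (x p ⬝ᵥ x q) ^ 2 = (-(β * Real.sin a)) ^ 2 by linarith,
      Real.sqrt_sq (by nlinarith)]
  have hd0 := Real.arccos_nonneg (x p ⬝ᵥ x q)
  have hd1 := Real.arccos_le_pi (x p ⬝ᵥ x q)
  set d := Real.arccos (x p ⬝ᵥ x q)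
  -- Here sin d = -β sin a, and hence sin (a + d) = α sin a. Its sign excludes a + d > π, so
  -- `arccos` returns a + d.
  have hsin : 0 ≤ Real.sin (a + d) := by
    rw [Real.sin_add, hsd, hca, hcd, e1]
    have : Real.sin a * (α + β * c) + c * -(β * Real.sin a) = Real.sin a * α := by ring
    rw [this]; positivity
  have hle : a + d ≤ Real.pi := by
    by_contra! h
    have := Real.sin_neg_of_neg_of_neg_pi_lt (x := a + d - 2 * Real.pi) (by linarith) (by linarith)
    rw [Real.sin_sub_two_pi] at this
    linarith
  have hcos : x (p + 1) ⬝ᵥ x q = Real.cos (a + d) := by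
    rw [Real.cos_add, hsd, hca, hcd, e1, e2]
    linear_combination (-β) * hsq
  rw [hcos, Real.arccos_cos (by linarith [ha.1]) hle]

/-! ### Openness of convexity and the first variation -/

section Variation

variable {ℓ τ : ℕ → ℝ} {k : ℝ} {p q : ℕ}

/-- In the chain of scale `k`, no straight part between the vertices `p` and `q` is longer than a
half great circle. -/
def StraightPartsLe (ℓ τ : ℕ → ℝ) (k : ℝ) (p q : ℕ) : Prop :=
  ∀ i j, p ≤ i → i < j → j ≤ q → (∀ m, i < m → m < j → τ m = 0) →
    k * (∑ m ∈ Finset.range j, ℓ m - ∑ m ∈ Finset.range i, ℓ m) ≤ Real.pi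

theorem StraightPartsLe.mono {p' q' : ℕ} (h : StraightPartsLe ℓ τ k p q) (hp : p ≤ p')
    (hq : q' ≤ q) : StraightPartsLe ℓ τ k p' q' := fun i j h1 h2 h3 h4 =>
  h i j (hp.trans h1) h2 (h3.trans hq) h4

theorem length_pos (hℓ : ∀ m, 0 < ℓ m) {i j : ℕ} (hij : i < j) :
    0 < ∑ m ∈ Finset.range j, ℓ m - ∑ m ∈ Finset.range i, ℓ m := by
  rw [← Finset.sum_Ico_eq_sub _ hij.le]
  exact Finset.sum_pos (fun m _ => hℓ m) ⟨i, Finset.mem_Ico.mpr ⟨le_rfl, hij⟩⟩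

theorem StraightPartsLe.scale (hℓ : ∀ m, 0 < ℓ m) {k' : ℝ} (h : StraightPartsLe ℓ τ k p q)
    (hk : k' ≤ k) : StraightPartsLe ℓ τ k' p q := fun i j h1 h2 h3 h4 =>
  (mul_le_mul_of_nonneg_right hk (length_pos hℓ h2).le).trans (h i j h1 h2 h3 h4)

theorem cross_pt_succ_ne_zero (hℓ : ∀ m, 0 < ℓ m) (hk : 0 < k) (hkℓ : ∀ m, k * ℓ m < Real.pi)
    (m : ℕ) : pt ℓ τ k m ⨯₃ pt ℓ τ k (m + 1) ≠ 0 := by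
  intro h
  have h1 := (frame_isOrtho (ℓ := ℓ) (τ := τ) k m).trip_advance (k * ℓ m) (frame ℓ τ k m).n
  rw [← pt_succ, ← pt, ← dot_cross, h, zero_dotProduct, (frame_isOrtho k m).nn, mul_one] at h1
  exact (Real.sin_pos_of_pos_of_lt_pi (mul_pos hk (hℓ m)) (hkℓ m)).ne h1

theorem turn_eq_zero_of_trip (hℓ : ∀ m, 0 < ℓ m) (hk : 0 < k) (hkℓ : ∀ m, k * ℓ m < Real.pi)
    (hτ : ∀ m, 0 ≤ τ m ∧ τ m < Real.pi) {m : ℕ}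
    (h : trip (pt ℓ τ k m) (pt ℓ τ k (m + 1)) (pt ℓ τ k (m + 2)) = 0) : τ (m + 1) = 0 := by
  rw [trip_consecutive] at h
  have h1 := Real.sin_pos_of_pos_of_lt_pi (mul_pos hk (hℓ m)) (hkℓ m)
  have h2 := Real.sin_pos_of_pos_of_lt_pi (mul_pos hk (hℓ (m + 1))) (hkℓ (m + 1))
  have h3 := ((mul_eq_zero.mp h).resolve_left h1.ne')
  have h4 := ((mul_eq_zero.mp h3).resolve_left h2.ne')
  by_contra h5
  exact (Real.sin_pos_of_pos_of_lt_pi (lt_of_le_of_ne (hτ _).1 (Ne.symm h5)) (hτ _).2).ne' h4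

theorem turn_eq_zero_of_orthogonal (hℓ : ∀ m, 0 < ℓ m) (hk : 0 < k)
    (hkℓ : ∀ m, k * ℓ m < Real.pi) (hτ : ∀ m, 0 ≤ τ m ∧ τ m < Real.pi) {i l : ℕ}
    (h : ∃ w : V3, w ≠ 0 ∧ ∀ m, i ≤ m → m ≤ l → w ⬝ᵥ pt ℓ τ k m = 0) {m : ℕ} (him : i < m)
    (hml : m < l) : τ m = 0 := by
  obtain ⟨w, hw, hw'⟩ := h
  obtain ⟨m, rfl⟩ : ∃ m', m = m' + 1 := ⟨m - 1, by omega⟩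
  exact turn_eq_zero_of_trip hℓ hk hkℓ hτ (trip_eq_zero_of_orthogonal hw
    (hw' _ (by omega) (by omega)) (hw' _ (by omega) (by omega)) (hw' _ (by omega) (by omega)))

/-- Convexity with strict corners at both ends of the chain is an open condition on the scale. -/
theorem eventually_orderedConvex (hℓ : ∀ m, 0 < ℓ m) (hk : 0 < k)
    (hkℓ : ∀ m, k * ℓ m < Real.pi) (hτ : ∀ m, 0 ≤ τ m ∧ τ m < Real.pi)
    (hc : OrderedConvex (pt ℓ τ k) p q)
    (hA : 0 < trip (pt ℓ τ k p) (pt ℓ τ k (p + 1)) (pt ℓ τ k q))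
    (hB : 0 < trip (pt ℓ τ k p) (pt ℓ τ k (q - 1)) (pt ℓ τ k q)) :
    ∀ᶠ κ in nhds k, OrderedConvex (pt ℓ τ κ) p q ∧
      0 < trip (pt ℓ τ κ p) (pt ℓ τ κ (p + 1)) (pt ℓ τ κ q) ∧
      0 < trip (pt ℓ τ κ p) (pt ℓ τ κ (q - 1)) (pt ℓ τ κ q) := by
  have hpos : ∀ i j l, 0 < trip (pt ℓ τ k i) (pt ℓ τ k j) (pt ℓ τ k l) →
      ∀ᶠ κ in nhds k, 0 < trip (pt ℓ τ κ i) (pt ℓ τ κ j) (pt ℓ τ κ l) := fun i j l h =>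
    (continuous_trip_pt i j l).continuousAt.eventually (lt_mem_nhds h)
  refine Filter.Eventually.and ?_ ((hpos _ _ _ hA).and (hpos _ _ _ hB))
  have h1 : ∀ᶠ κ in nhds k, ∀ i ∈ Finset.range (q + 1), ∀ j ∈ Finset.range (q + 1),
      ∀ l ∈ Finset.range (q + 1), p ≤ i → i < j → j < l →
        0 ≤ trip (pt ℓ τ κ i) (pt ℓ τ κ j) (pt ℓ τ κ l) := by
    simp only [Filter.eventually_all_finset]
    intro i _ j _ l hl
    by_cases hijl : p ≤ i ∧ i < j ∧ j < l
    · obtain ⟨h1, h2, h3⟩ := hijl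
      have hlq : l ≤ q := by have := Finset.mem_range.mp hl; omega
      -- A zero triple belongs to a straight run and stays zero at every scale; a positive one stays
      -- positive nearby.
      rcases eq_or_lt_of_le (hc i j l h1 h2 h3 hlq) with h4 | h4
      · have h5 := exists_orthogonal_of_trip_eq_zero (pt_unit k)
          (fun i _ _ => cross_pt_succ_ne_zero hℓ hk hkℓ i) hc hA hB h1 h2 h3 hlq h4.symm
        refine Filter.Eventually.of_forall fun κ _ _ _ => ?_
        rw [trip_straight h2 h3 fun m h6 h7 => turn_eq_zero_of_orthogonal hℓ hk hkℓ hτ h5 h6 h7]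
      · filter_upwards [hpos i j l h4] with κ h _ _ _ using h.le
    · exact Filter.Eventually.of_forall fun κ h1 h2 h3 => absurd ⟨h1, h2, h3⟩ hijl
  filter_upwards [h1] with κ h i j l h2 h3 h4 h5
  exact h i (Finset.mem_range.mpr (by omega)) j (Finset.mem_range.mpr (by omega)) l
    (Finset.mem_range.mpr (by omega)) h2 h3 h4

theorem edgeMoment_straight {i j : ℕ} (hij : i < j) (hs : ∀ m, i < m → m < j → τ m = 0)
    (h0 : 0 < k * (∑ m ∈ Finset.range j, ℓ m - ∑ m ∈ Finset.range i, ℓ m))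
    (hpi : k * (∑ m ∈ Finset.range j, ℓ m - ∑ m ∈ Finset.range i, ℓ m) < Real.pi) (u : V3) :
    edgeMoment (pt ℓ τ k i) (pt ℓ τ k j) u =
      k * (∑ m ∈ Finset.range j, ℓ m - ∑ m ∈ Finset.range i, ℓ m)
        * ((frame ℓ τ k i).n ⬝ᵥ u) := by
  unfold edgeMoment
  rw [pt_straight hij hs, pt, (frame_isOrtho k i).trip_advance, (frame_isOrtho k i).dot_advance,
    Real.arccos_cos h0.le hpi.le]
  have := (Real.sin_pos_of_pos_of_lt_pi h0 hpi).ne'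
  field_simp

theorem edgeMoment_succ (hℓ : ∀ m, 0 < ℓ m) (hk : 0 < k) (hkℓ : ∀ m, k * ℓ m < Real.pi) (m : ℕ)
    (u : V3) : edgeMoment (pt ℓ τ k m) (pt ℓ τ k (m + 1)) u =
      k * ℓ m * ((frame ℓ τ k m).n ⬝ᵥ u) := by
  have e : k * (∑ i ∈ Finset.range (m + 1), ℓ i - ∑ i ∈ Finset.range m, ℓ i) = k * ℓ m := by
    rw [Finset.sum_range_succ]; ring
  have h := edgeMoment_straight (ℓ := ℓ) (τ := τ) (k := k) (Nat.lt_succ_self m)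
    (fun i h1 h2 => by omega) (by rw [Nat.succ_eq_add_one, e]; exact mul_pos hk (hℓ m))
    (by rw [Nat.succ_eq_add_one, e]; exact hkℓ m) u
  rwa [Nat.succ_eq_add_one, e] at h

/-- The sum of the edge moments of a convex polygon has a positive component in the direction of
the pole of its closing edge. -/
theorem edgeMoment_polygon_pos (hℓ : ∀ m, 0 < ℓ m) (hk : 0 < k)
    (hkℓ : ∀ m, k * ℓ m < Real.pi) (hτ : ∀ m, 0 ≤ τ m ∧ τ m < Real.pi)
    (hsp : StraightPartsLe ℓ τ k p q) (hpq : p + 2 ≤ q)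
    (hc : OrderedConvex (pt ℓ τ k) p q)
    (hA : 0 < trip (pt ℓ τ k p) (pt ℓ τ k (p + 1)) (pt ℓ τ k q))
    (hB : 0 < trip (pt ℓ τ k p) (pt ℓ τ k (q - 1)) (pt ℓ τ k q)) :
    0 < ∑ m ∈ Finset.Ico p q,
        k * ℓ m * ((frame ℓ τ k m).n ⬝ᵥ (pt ℓ τ k q ⨯₃ pt ℓ τ k p))
      + edgeMoment (pt ℓ τ k q) (pt ℓ τ k p) (pt ℓ τ k q ⨯₃ pt ℓ τ k p) := by
  set u := pt ℓ τ k q ⨯₃ pt ℓ τ k p with hu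
  have hdot : ∀ j, pt ℓ τ k j ⬝ᵥ u = trip (pt ℓ τ k p) (pt ℓ τ k j) (pt ℓ τ k q) := fun j => by
    rw [hu]; exact (trip_rot _ _ _).symm
  have hup : 0 ≤ pt ℓ τ k p ⬝ᵥ u := by rw [hdot, trip_left_eq]
  have huq : pt ℓ τ k q ⬝ᵥ u = 0 := by rw [hdot, trip_right_eq]
  have huj : ∀ j, p < j → j < q → 0 < pt ℓ τ k j ⬝ᵥ u := fun j h1 h2 => by
    rw [hdot]; exact trip_ends_pos (pt_unit k) hc hA hB h1 h2
  have hstep : ∀ j, p < j → j < q →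
      0 < trip (pt ℓ τ k p) (pt ℓ τ k j) (pt ℓ τ k (j + 1)) →
      edgeMoment (pt ℓ τ k j) (pt ℓ τ k p) u < k * ℓ j * ((frame ℓ τ k j).n ⬝ᵥ u)
        + edgeMoment (pt ℓ τ k (j + 1)) (pt ℓ τ k p) u := by
    intro j h1 h2 h3
    have h4 : 0 ≤ pt ℓ τ k (j + 1) ⬝ᵥ u := by
      rcases eq_or_lt_of_le (show j + 1 ≤ q from h2) with h | h
      · rw [h, huq]
      · exact (huj _ (by omega) h).le
    have h5 := edgeMoment_sum_pos (pt_unit k p) (pt_unit k j) (pt_unit k (j + 1)) h3 hup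
      (huj j h1 h2).le h4 (Or.inl (huj j h1 h2))
    rw [edgeMoment_succ hℓ hk hkℓ, edgeMoment_swap (pt ℓ τ k p) (pt ℓ τ k j)] at h5
    linarith
  -- Only a weak inequality is available for partial fans, because a straight initial run
  -- contributes zero. Strictness comes from the last triangle, which is nondegenerate by `hB`.
  have hfan : ∀ j, p + 1 ≤ j → j < q →
      0 ≤ ∑ m ∈ Finset.Ico p j, k * ℓ m * ((frame ℓ τ k m).n ⬝ᵥ u)
        + edgeMoment (pt ℓ τ k j) (pt ℓ τ k p) u := by
    intro j hj
    induction j, hj using Nat.le_induction with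
    | base =>
      intro _
      rw [Finset.sum_Ico_succ_top le_rfl, Finset.Ico_self, Finset.sum_empty,
        edgeMoment_swap, edgeMoment_succ hℓ hk hkℓ]
      linarith
    | succ j hj ih =>
      intro hjq
      have ih := ih (by omega)
      rcases eq_or_lt_of_le (hc p j (j + 1) le_rfl (by omega) (by omega) hjq.le) with h | h
      · have h5 := exists_orthogonal_of_trip_eq_zero (pt_unit k)
          (fun i _ _ => cross_pt_succ_ne_zero hℓ hk hkℓ i) hc hA hB le_rfl (by omega)
            (Nat.lt_succ_self j) hjq.le h.symm
        have h6 : ∀ m, p < m → m < j + 1 → τ m = 0 := fun m h6 h7 =>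
          turn_eq_zero_of_orthogonal hℓ hk hkℓ hτ h5 h6 h7
        have h7 := mul_pos hk (length_pos hℓ (show p < j + 1 by omega))
        have h8 := hsp p (j + 1) le_rfl (by omega) hjq.le h6
        -- A run of length π would end at the antipode of its start, on the great circle of the
        -- closing edge.
        have h9 : k * (∑ m ∈ Finset.range (j + 1), ℓ m - ∑ m ∈ Finset.range p, ℓ m)
            ≠ Real.pi := by
          intro h9
          have h10 := pt_straight (ℓ := ℓ) (k := k) (show p < j + 1 by omega) h6
          have h11 := trip_ends_pos (pt_unit k) hc hA hB (show p < j + 1 by omega) hjq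
          rw [h10, pt, (frame_isOrtho k p).trip_advance, h9, Real.sin_pi, zero_mul] at h11
          exact lt_irrefl _ h11
        rw [edgeMoment_swap, edgeMoment_straight (by omega) h6 h7 (lt_of_le_of_ne h8 h9),
          ← Finset.sum_Ico_eq_sub _ (show p ≤ j + 1 by omega), Finset.mul_sum, Finset.sum_mul,
          ← sub_eq_add_neg, ← Finset.sum_sub_distrib]
        refine (Finset.sum_eq_zero fun m hm => ?_).ge
        rw [Finset.mem_Ico] at hm
        rw [frame_straight hm.1 fun i h1 h2 => h6 i h1 (by omega)]
        simp [Frame.advance]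
      · have := hstep j (by omega) (by omega) h
        rw [Finset.sum_Ico_succ_top (by omega)]
        linarith
  obtain ⟨j, rfl⟩ : ∃ j, q = j + 1 := ⟨q - 1, by omega⟩
  rw [Nat.add_sub_cancel] at hB
  have h1 := hfan j (by omega) (by omega)
  have h2 := hstep j (by omega) (by omega) hB
  rw [Finset.sum_Ico_succ_top (by omega)]
  linarith

/-- The first variation of the distance of the ends of a convex chain, divided by the scale. -/
theorem exists_hasDerivAt_arccos_div_neg (hℓ : ∀ m, 0 < ℓ m) (hk : 0 < k)
    (hkℓ : ∀ m, k * ℓ m < Real.pi) (hτ : ∀ m, 0 ≤ τ m ∧ τ m < Real.pi)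
    (hsp : StraightPartsLe ℓ τ k p q) (hpq : p + 2 ≤ q)
    (hc : OrderedConvex (pt ℓ τ k) p q)
    (hA : 0 < trip (pt ℓ τ k p) (pt ℓ τ k (p + 1)) (pt ℓ τ k q))
    (hB : 0 < trip (pt ℓ τ k p) (pt ℓ τ k (q - 1)) (pt ℓ τ k q)) :
    ∃ d < 0, HasDerivAt (fun k => Real.arccos (pt ℓ τ k p ⬝ᵥ pt ℓ τ k q) / k) d k := by
  have hlt := abs_dot_lt_one (pt_unit k p) (pt_unit k q) (z := pt ℓ τ k (p + 1))
    (by rw [trip_swap]; exact (neg_neg_of_pos hA).ne)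
  have hd := (Real.hasDerivAt_arccos hlt.1.ne' hlt.2.ne).comp k
    (hasDerivAt_dot_pt (ℓ := ℓ) (τ := τ) (show p ≤ q by omega) k)
  have hd' := hd.div (hasDerivAt_id k) hk.ne'
  refine ⟨_, ?_, hd'⟩
  have hX := edgeMoment_polygon_pos hℓ hk hkℓ hτ hsp hpq hc hA hB
  have hD := arccos_mem hlt.1 hlt.2
  have hsD := Real.sin_pos_of_pos_of_lt_pi hD.1 hD.2
  have em : edgeMoment (pt ℓ τ k q) (pt ℓ τ k p) (pt ℓ τ k q ⨯₃ pt ℓ τ k p) =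
      Real.arccos (pt ℓ τ k p ⬝ᵥ pt ℓ τ k q)
        * Real.sin (Real.arccos (pt ℓ τ k p ⬝ᵥ pt ℓ τ k q)) := by
    unfold edgeMoment
    rw [← dot_cross, cross_dot_self, pt_unit, pt_unit,
      dotProduct_comm (pt ℓ τ k q) (pt ℓ τ k p)]
    have e := Real.sin_sq (Real.arccos (pt ℓ τ k p ⬝ᵥ pt ℓ τ k q))
    rw [Real.cos_arccos hlt.1.le hlt.2.le] at e
    rw [one_mul, ← e]
    field_simp
  rw [em] at hX
  simp only [mul_assoc k] at hX
  rw [← Finset.mul_sum] at hX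
  rw [← Real.sin_arccos]
  set S := ∑ m ∈ Finset.Ico p q,
    ℓ m * ((frame ℓ τ k m).n ⬝ᵥ (pt ℓ τ k q ⨯₃ pt ℓ τ k p))
  simp only [Function.comp, id]
  set D := Real.arccos (pt ℓ τ k p ⬝ᵥ pt ℓ τ k q)
  refine div_neg_of_neg_of_pos ?_ (by positivity)
  have e : -(1 / Real.sin D) * S * k - D * 1 = -((k * S + D * Real.sin D) / Real.sin D) := by
    field_simp
    ring
  rw [e]
  exact neg_neg_of_pos (div_pos hX hsD)

end Variation

/-- The strict triangle inequality for two sides `a`, `c` with exterior angle `b` between them: it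
is strict because the path does not turn back on itself. -/
theorem sub_lt_arccos_hinge {a b c : ℝ} (ha : 0 < a) (ha' : a < Real.pi) (hc : 0 < c)
    (hc' : c < Real.pi) (hb : 0 ≤ b) (hb' : b < Real.pi) :
    c - a < Real.arccos (Real.cos a * Real.cos c - Real.cos b * (Real.sin a * Real.sin c)) := by
  have hs := mul_pos (Real.sin_pos_of_pos_of_lt_pi ha ha') (Real.sin_pos_of_pos_of_lt_pi hc hc')
  rcases lt_or_ge (c - a) 0 with h | h
  · exact h.trans_le (Real.arccos_nonneg _)
  · have hcos : -1 < Real.cos b := by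
      rw [← Real.cos_pi]
      exact Real.cos_lt_cos_of_nonneg_of_le_pi hb le_rfl hb'
    have h1 : Real.cos a * Real.cos c - Real.cos b * (Real.sin a * Real.sin c)
        < Real.cos (c - a) := by
      rw [Real.cos_sub]; nlinarith
    have h2 : -1 ≤ Real.cos a * Real.cos c - Real.cos b * (Real.sin a * Real.sin c) := by
      have := Real.neg_one_le_cos (a + c)
      rw [Real.cos_add] at this
      nlinarith [Real.cos_le_one b]
    have := Real.arccos_lt_arccos h2 h1 (Real.cos_le_one _)
    rwa [Real.arccos_cos h (by linarith)] at this

/-- The distance on the unit sphere between two vertices of the chain. -/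
noncomputable def chord (ℓ τ : ℕ → ℝ) (k : ℝ) (p q : ℕ) : ℝ :=
  Real.arccos (pt ℓ τ k p ⬝ᵥ pt ℓ τ k q)

/-! ### Comparison of two scales by induction on the chain -/

section Comparison

variable {ℓ τ : ℕ → ℝ} {k k' : ℝ} {p q : ℕ}

theorem chord_comm (k : ℝ) (p q : ℕ) : chord ℓ τ k p q = chord ℓ τ k q p := by
  rw [chord, chord, dotProduct_comm]

theorem chord_straight {i j : ℕ} (hij : i < j) (hs : ∀ m, i < m → m < j → τ m = 0)
    (h0 : 0 ≤ k * (∑ m ∈ Finset.range j, ℓ m - ∑ m ∈ Finset.range i, ℓ m))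
    (hpi : k * (∑ m ∈ Finset.range j, ℓ m - ∑ m ∈ Finset.range i, ℓ m) ≤ Real.pi) :
    chord ℓ τ k i j = k * (∑ m ∈ Finset.range j, ℓ m - ∑ m ∈ Finset.range i, ℓ m) := by
  rw [chord, pt_straight hij hs, pt, (frame_isOrtho k i).dot_advance, Real.arccos_cos h0 hpi]

theorem chord_succ (hℓ : ∀ m, 0 < ℓ m) (hk : 0 < k) (hkℓ : ∀ m, k * ℓ m < Real.pi) (m : ℕ) :
    chord ℓ τ k m (m + 1) = k * ℓ m := by
  rw [chord, pt_succ, pt, (frame_isOrtho k m).dot_advance,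
    Real.arccos_cos (mul_pos hk (hℓ m)).le (hkℓ m).le]

theorem chord_le (k : ℝ) (p q r : ℕ) : chord ℓ τ k q r ≤ chord ℓ τ k p q + chord ℓ τ k r p :=
  arccos_sub_le (pt_unit k p) (pt_unit k q) (pt_unit k r)

/-- If one end `p` of a convex chain lies between its neighbour `i` and the other end `q`, the
comparison for the chain follows from the comparison for the chain without this end. -/
theorem chord_div_lt_of_between {i : ℕ} {l : ℝ} (hk' : 0 < k') (hk : 0 < k)
    (hl' : chord ℓ τ k' i p = k' * l)
    (hbetween : chord ℓ τ k i q = k * l + chord ℓ τ k p q)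
    (hlt : chord ℓ τ k i q / k < chord ℓ τ k' i q / k' ∨
      chord ℓ τ k i q / k ≤ chord ℓ τ k' i q / k' ∧
        chord ℓ τ k' i q - k' * l < chord ℓ τ k' p q) :
    chord ℓ τ k p q / k < chord ℓ τ k' p q / k' := by
  have h1 : chord ℓ τ k p q / k = chord ℓ τ k i q / k - l := by
    rw [hbetween]; field_simp; ring
  have h2 : (chord ℓ τ k' i q - k' * l) / k' = chord ℓ τ k' i q / k' - l := by
    field_simp
  rw [h1]
  rcases hlt with h | ⟨h, h'⟩
  · have h3 := chord_le (ℓ := ℓ) (τ := τ) k' p i q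
    rw [chord_comm k' p i, hl', chord_comm k' q p] at h3
    have h4 : (chord ℓ τ k' i q - k' * l) / k' ≤ chord ℓ τ k' p q / k' :=
      div_le_div_of_nonneg_right (by linarith) hk'.le
    linarith
  · have h4 : (chord ℓ τ k' i q - k' * l) / k' < chord ℓ τ k' p q / k' :=
      div_lt_div_of_pos_right h' hk'
    linarith

variable (hℓ : ∀ m, 0 < ℓ m) (hτ : ∀ m, 0 ≤ τ m ∧ τ m < Real.pi) (hk' : 0 < k') (hkk' : k' < k)
  (hkℓ : ∀ m, k * ℓ m < Real.pi)

include hℓ hτ hk' hkk' hkℓ in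
-- Removal of the first vertex. If the remaining chain still turns, the inductive inequality is
-- strict. If it is straight, its scaled chords agree, and strictness comes from the hinge at `p +
-- 1` on the sphere of scale `k'`.
theorem chord_div_lt_of_first (hsp : StraightPartsLe ℓ τ k p q)
    (hc : OrderedConvex (pt ℓ τ k) p q) (hns : ∃ m, p < m ∧ m < q ∧ τ m ≠ 0)
    (hA : trip (pt ℓ τ k p) (pt ℓ τ k (p + 1)) (pt ℓ τ k q) = 0)
    (IH : (∃ m, p + 1 < m ∧ m < q ∧ τ m ≠ 0) →
      chord ℓ τ k (p + 1) q / k < chord ℓ τ k' (p + 1) q / k') :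
    chord ℓ τ k p q / k < chord ℓ τ k' p q / k' := by
  have hk : 0 < k := hk'.trans hkk'
  have hkℓ' : ∀ m, k' * ℓ m < Real.pi := fun m =>
    (mul_lt_mul_of_pos_right hkk' (hℓ m)).trans (hkℓ m)
  obtain ⟨m, hm1, hm2, hm⟩ := hns
  have hstep := cross_pt_succ_ne_zero (τ := τ) hℓ hk hkℓ p
  have hex : ∃ i, p + 1 < i ∧ i < q ∧
      0 < trip (pt ℓ τ k p) (pt ℓ τ k (p + 1)) (pt ℓ τ k i) := by
    by_contra! hcon
    refine hm (turn_eq_zero_of_orthogonal hℓ hk hkℓ hτ (i := p) (l := q)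
      ⟨_, hstep, fun j h1 h2 => ?_⟩ hm1 hm2)
    rw [dot_cross]
    rcases eq_or_lt_of_le h1 with rfl | h1
    · exact trip_outer_eq _ _
    rcases eq_or_lt_of_le (show p + 1 ≤ j from h1) with rfl | h1
    · exact trip_right_eq _ _
    rcases eq_or_lt_of_le h2 with rfl | h2
    · exact hA
    · exact le_antisymm (hcon j h1 h2) (hc _ _ _ le_rfl (by omega) h1 h2.le)
  have hb := arccos_dot_eq_add (pt_unit k) hstep hc hA hex
  change chord ℓ τ k (p + 1) q = chord ℓ τ k p (p + 1) + chord ℓ τ k p q at hb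
  rw [chord_succ hℓ hk hkℓ] at hb
  refine chord_div_lt_of_between hk' hk
    (by rw [chord_comm, chord_succ hℓ hk' hkℓ']) hb ?_
  by_cases hs : ∃ m, p + 1 < m ∧ m < q ∧ τ m ≠ 0
  · exact Or.inl (IH hs)
  · right
    push Not at hs
    have hpq : p + 1 < q := by omega
    have hpos := length_pos hℓ hpq
    have hle := hsp (p + 1) q (by omega) hpq le_rfl hs
    have hlt := (mul_lt_mul_of_pos_right hkk' hpos).trans_le hle
    rw [chord_straight hpq hs (mul_pos hk hpos).le hle,
      chord_straight hpq hs (mul_pos hk' hpos).le hlt.le, mul_div_cancel_left₀ _ hk.ne',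
      mul_div_cancel_left₀ _ hk'.ne']
    refine ⟨le_rfl, ?_⟩
    have := sub_lt_arccos_hinge (mul_pos hk' (hℓ p)) (hkℓ' p) (mul_pos hk' hpos) hlt
      (hτ (p + 1)).1 (hτ (p + 1)).2
    rw [← (frame_isOrtho (ℓ := ℓ) (τ := τ) k' p).dot_advance_turn_advance] at this
    rw [chord, pt_straight (k := k') hpq hs]
    exact this

include hℓ hτ hk' hkk' hkℓ in
-- The mirror case. Reflection supplies only the betweenness at scale `k`; the hinge at `q - 1` is
-- computed with the frames in their original direction.
theorem chord_div_lt_of_last (hsp : StraightPartsLe ℓ τ k p q)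
    (hc : OrderedConvex (pt ℓ τ k) p q) (hns : ∃ m, p < m ∧ m < q ∧ τ m ≠ 0)
    (hB : trip (pt ℓ τ k p) (pt ℓ τ k (q - 1)) (pt ℓ τ k q) = 0)
    (IH : (∃ m, p < m ∧ m < q - 1 ∧ τ m ≠ 0) →
      chord ℓ τ k p (q - 1) / k < chord ℓ τ k' p (q - 1) / k') :
    chord ℓ τ k p q / k < chord ℓ τ k' p q / k' := by
  have hk : 0 < k := hk'.trans hkk'
  have hkℓ' : ∀ m, k' * ℓ m < Real.pi := fun m =>
    (mul_lt_mul_of_pos_right hkk' (hℓ m)).trans (hkℓ m)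
  obtain ⟨m, hm1, hm2, hm⟩ := hns
  obtain ⟨r, rfl⟩ : ∃ r, q = r + 2 := ⟨q - 2, by omega⟩
  rw [show r + 2 - 1 = r + 1 from rfl] at *
  have hstep := cross_pt_succ_ne_zero (τ := τ) hℓ hk hkℓ (r + 1)
  have hex : ∃ i, p < i ∧ i < r + 1 ∧
      0 < trip (pt ℓ τ k i) (pt ℓ τ k (r + 1)) (pt ℓ τ k (r + 2)) := by
    by_contra! hcon
    refine hm (turn_eq_zero_of_orthogonal hℓ hk hkℓ hτ (i := p) (l := r + 2)
      ⟨_, hstep, fun j h1 h2 => ?_⟩ hm1 hm2)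
    rw [dot_cross, ← trip_rot]
    rcases eq_or_lt_of_le h1 with rfl | h1
    · exact hB
    rcases eq_or_lt_of_le h2 with rfl | h2
    · exact trip_outer_eq _ _
    rcases eq_or_lt_of_le (show j ≤ r + 1 by omega) with rfl | h2
    · exact trip_left_eq _ _
    · exact le_antisymm (hcon j h1 h2) (hc _ _ _ h1.le h2 (by omega) le_rfl)
  set x := pt ℓ τ k with hx
  have e0 : p + (r + 2) - p = r + 2 := by omega
  have e1 : p + (r + 2) - (p + 1) = r + 1 := by omega
  have e2 : p + (r + 2) - (r + 2) = p := by omega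
  have hb := arccos_dot_eq_add (x := reflect x p (r + 2)) (p := p) (q := r + 2)
    (fun i => by rw [dot_reflect, hx, pt_unit])
    (by
      intro h
      refine hstep ?_
      rw [reflect, reflect, e0, e1, map_neg, map_neg, LinearMap.neg_apply, neg_neg] at h
      rw [← cross_anticomm, h, neg_zero])
    hc.reflect (by rw [trip_reflect, e0, e1, e2]; exact hB)
    (by
      obtain ⟨i, h1, h2, h3⟩ := hex
      refine ⟨p + (r + 2) - i, by omega, by omega, ?_⟩
      rw [trip_reflect, e0, e1, show p + (r + 2) - (p + (r + 2) - i) = i by omega]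
      exact h3)
  rw [dot_reflect, dot_reflect, dot_reflect, e0, e1, e2] at hb
  change chord ℓ τ k (r + 1) p = chord ℓ τ k (r + 2) (r + 1) + chord ℓ τ k (r + 2) p at hb
  have hs1 := chord_succ (τ := τ) hℓ hk hkℓ (r + 1)
  rw [chord_comm k (r + 2), hs1] at hb
  rw [chord_comm k p, chord_comm k' p]
  rw [chord_comm k p, chord_comm k' p] at IH
  refine chord_div_lt_of_between hk' hk (chord_succ (τ := τ) hℓ hk' hkℓ' (r + 1)) hb ?_
  by_cases hs : ∃ m, p < m ∧ m < r + 1 ∧ τ m ≠ 0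
  · exact Or.inl (IH hs)
  · right
    push Not at hs
    have hpq : p < r + 1 := by omega
    have hpos := length_pos hℓ hpq
    have hle := hsp p (r + 1) le_rfl hpq (by omega) hs
    have hlt := (mul_lt_mul_of_pos_right hkk' hpos).trans_le hle
    rw [chord_comm k (r + 1), chord_comm k' (r + 1), chord_comm k' (r + 2),
      chord_straight hpq hs (mul_pos hk hpos).le hle,
      chord_straight hpq hs (mul_pos hk' hpos).le hlt.le, mul_div_cancel_left₀ _ hk.ne',
      mul_div_cancel_left₀ _ hk'.ne']
    refine ⟨le_rfl, ?_⟩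
    have := sub_lt_arccos_hinge (mul_pos hk' (hℓ (r + 1))) (hkℓ' (r + 1)) (mul_pos hk' hpos) hlt
      (hτ (r + 1)).1 (hτ (r + 1)).2
    rw [mul_comm (Real.cos (k' * ℓ (r + 1))), mul_comm (Real.sin (k' * ℓ (r + 1))),
      ← (frame_isOrtho (ℓ := ℓ) (τ := τ) k' p).dot_advance_turn_advance] at this
    rw [chord, pt_succ, frame]
    have e3 := frame_straight (ℓ := ℓ) (τ := τ) (k := k') (show p ≤ r by omega)
      fun m h1 h2 => hs m h1 (by omega)
    rw [e3, Frame.advance_advance, ← mul_add,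
      show ∑ m ∈ Finset.range r, ℓ m - ∑ m ∈ Finset.range p, ℓ m + ℓ r
        = ∑ m ∈ Finset.range (r + 1), ℓ m - ∑ m ∈ Finset.range p, ℓ m by
        rw [Finset.sum_range_succ]; ring]
    exact this

theorem continuousOn_chord_div {s : Set ℝ} (hs : ∀ k ∈ s, 0 < k) (p q : ℕ) :
    ContinuousOn (fun k => chord ℓ τ k p q / k) s := by
  refine ContinuousOn.div (Continuous.continuousOn ?_) continuousOn_id fun k hk => (hs k hk).ne'
  refine Real.continuous_arccos.comp ?_
  exact Continuous.dotProduct (continuous_pt p) (continuous_pt q)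

include hℓ hτ in
/-- For convex chains with given edge lengths and angles on spheres, the distance of the ends
increases with the radius. -/
theorem chord_div_lt (hk' : 0 < k') : ∀ (d p q : ℕ) (k : ℝ), q = p + d → k' < k →
    (∀ m, k * ℓ m < Real.pi) → StraightPartsLe ℓ τ k p q → OrderedConvex (pt ℓ τ k) p q →
    (∃ m, p < m ∧ m < q ∧ τ m ≠ 0) → chord ℓ τ k p q / k < chord ℓ τ k' p q / k' := by
  intro d
  induction d with
  | zero =>
    rintro p q k hq - - - - ⟨m, h1, h2, -⟩
    omega
  | succ d ih =>
    intro p q k hq hkk' hkℓ hsp hc hns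
    have hpq : p + 2 ≤ q := by
      obtain ⟨m, h1, h2, -⟩ := hns
      omega
    -- At a weakly convex scale with a straight end corner, the comparison with `k'` comes from a
    -- chain with one edge fewer.
    have hstuck : ∀ κ, k' < κ → κ ≤ k → OrderedConvex (pt ℓ τ κ) p q →
        ¬ (0 < trip (pt ℓ τ κ p) (pt ℓ τ κ (p + 1)) (pt ℓ τ κ q) ∧
          0 < trip (pt ℓ τ κ p) (pt ℓ τ κ (q - 1)) (pt ℓ τ κ q)) →
        chord ℓ τ κ p q / κ < chord ℓ τ k' p q / k' := by
      intro κ h1 h2 h3 h4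
      have hκℓ : ∀ m, κ * ℓ m < Real.pi := fun m =>
        (mul_le_mul_of_nonneg_right h2 (hℓ m).le).trans_lt (hkℓ m)
      have hκsp := hsp.scale hℓ h2
      by_cases hA : 0 < trip (pt ℓ τ κ p) (pt ℓ τ κ (p + 1)) (pt ℓ τ κ q)
      · have hB := fun h => h4 ⟨hA, h⟩
        have hB := le_antisymm (not_lt.mp hB)
          (h3 p (q - 1) q le_rfl (by omega) (by omega) le_rfl)
        exact chord_div_lt_of_last hℓ hτ hk' h1 hκℓ hκsp h3 hns hB fun h =>
          ih p (q - 1) κ (by omega) h1 hκℓ (hκsp.mono le_rfl (by omega))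
            (h3.mono le_rfl (by omega)) h
      · have hA := le_antisymm (not_lt.mp hA)
          (h3 p (p + 1) q le_rfl (by omega) (by omega) le_rfl)
        exact chord_div_lt_of_first hℓ hτ hk' h1 hκℓ hκsp h3 hns hA fun h =>
          ih (p + 1) q κ (by omega) h1 hκℓ (hκsp.mono (by omega) le_rfl)
            (h3.mono (by omega) le_rfl) h
    set G : Set ℝ := {κ | OrderedConvex (pt ℓ τ κ) p q ∧
      0 < trip (pt ℓ τ κ p) (pt ℓ τ κ (p + 1)) (pt ℓ τ κ q) ∧
      0 < trip (pt ℓ τ κ p) (pt ℓ τ κ (q - 1)) (pt ℓ τ κ q)} with hG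
    have hloc : ∀ κ, k' ≤ κ → κ ≤ k → 0 < κ ∧ (∀ m, κ * ℓ m < Real.pi) := fun κ h1 h2 =>
      ⟨by linarith, fun m => (mul_le_mul_of_nonneg_right h2 (hℓ m).le).trans_lt (hkℓ m)⟩
    have hopen : ∀ κ, k' ≤ κ → κ ≤ k → κ ∈ G → κ ∈ interior G := by
      intro κ h1 h2 h3
      rw [mem_interior_iff_mem_nhds]
      exact eventually_orderedConvex hℓ (hloc κ h1 h2).1 (hloc κ h1 h2).2 hτ h3.1 h3.2.1 h3.2.2
    have hanti : ∀ κ, k' ≤ κ → κ < k → (∀ s, κ < s → s ≤ k → s ∈ G) →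
        chord ℓ τ k p q / k < chord ℓ τ κ p q / κ := by
      intro κ h1 h2 h3
      have : StrictAntiOn (fun k => chord ℓ τ k p q / k) (Set.Icc κ k) := by
        refine strictAntiOn_of_deriv_neg (convex_Icc _ _)
          (continuousOn_chord_div (fun s hs => (hloc s (h1.trans hs.1) hs.2).1) p q)
          fun s hs => ?_
        rw [interior_Icc] at hs
        have hG := h3 s hs.1 hs.2.le
        have hl := hloc s (h1.trans hs.1.le) hs.2.le
        obtain ⟨d, hd, hd'⟩ := exists_hasDerivAt_arccos_div_neg hℓ hl.1 hl.2 hτ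
          (hsp.scale hℓ hs.2.le) hpq hG.1 hG.2.1 hG.2.2
        have hd'' : HasDerivAt (fun k => chord ℓ τ k p q / k) d s := hd'
        rw [hd''.deriv]
        exact hd
      exact this ⟨le_rfl, h2.le⟩ ⟨h2.le, le_rfl⟩ h2
    by_cases hkG : k ∈ G
    swap
    · exact hstuck k hkk' le_rfl hc fun h => hkG ⟨hc, h⟩
    -- The largest bad scale κ is where the descent from `k` stops. The function decreases strictly
    -- on [κ, k], and κ inherits weak convexity as a limit of good scales.
    have hcomp : IsCompact (Set.Icc k' k ∩ (interior G)ᶜ) :=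
      isCompact_Icc.inter_right isOpen_interior.isClosed_compl
    rcases Set.eq_empty_or_nonempty (Set.Icc k' k ∩ (interior G)ᶜ) with hem | hne
    · refine hanti k' le_rfl hkk' fun s h1 h2 => ?_
      by_contra hs
      exact (Set.ext_iff.mp hem s).mp ⟨⟨h1.le, h2⟩, fun h => hs (interior_subset h)⟩
    · obtain ⟨κ, ⟨⟨hκ1, hκ2⟩, hκG⟩, hmax⟩ := hcomp.exists_isGreatest hne
      have hκk : κ < k := lt_of_le_of_ne hκ2 (by
        rintro rfl
        exact hκG (hopen κ hκ1 le_rfl hkG))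
      have hgood : ∀ s, κ < s → s ≤ k → s ∈ G := by
        intro s h1 h2
        by_contra hs
        exact absurd (hmax ⟨⟨hκ1.trans h1.le, h2⟩, fun h => hs (interior_subset h)⟩)
          (not_le.mpr h1)
      have h1 := hanti κ hκ1 hκk hgood
      rcases eq_or_lt_of_le hκ1 with rfl | hκ1
      · exact h1
      have hκc : OrderedConvex (pt ℓ τ κ) p q := by
        intro i j l e1 e2 e3 e4
        have hcl : closure (Set.Ioc κ k) ⊆
            {s | 0 ≤ trip (pt ℓ τ s i) (pt ℓ τ s j) (pt ℓ τ s l)} :=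
          closure_minimal (fun s hs => (hgood s hs.1 hs.2).1 i j l e1 e2 e3 e4)
            (isClosed_le continuous_const (continuous_trip_pt i j l))
        rw [closure_Ioc hκk.ne] at hcl
        exact hcl ⟨le_rfl, hκk.le⟩
      exact h1.trans (hstuck κ hκ1 hκ2 hκc fun h => hκG (hopen κ hκ1.le hκ2 ⟨hκc, h⟩))

end Comparison

/-! ### Identification of a convex polygon with a model chain -/

namespace Frame

/-- The vector with given coordinates in a frame. -/
def place (F : Frame) (v : V3) : V3 := v 0 • F.x + v 1 • F.t + v 2 • F.n

theorem place_comb (F : Frame) (α β : ℝ) (v w : V3) :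
    F.place (α • v + β • w) = α • F.place v + β • F.place w := by
  simp only [place, Pi.add_apply, Pi.smul_apply, smul_eq_mul]
  module

theorem IsOrtho.place_dot {F : Frame} (h : F.IsOrtho) (v w : V3) :
    F.place v ⬝ᵥ F.place w = v ⬝ᵥ w := by
  simp only [place, add_dotProduct, dotProduct_add, smul_dotProduct, dotProduct_smul, h.xx, h.tt,
    h.nn, h.xt, h.tx, h.xn, h.nx, h.tn, h.nt, smul_eq_mul, dot_eq v w]
  ring

theorem IsOrtho.place_trip {F : Frame} (h : F.IsOrtho) (u v w : V3) :
    trip (F.place u) (F.place v) (F.place w) = trip u v w := by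
  have h1 : trip F.x F.t F.n = 1 := by rw [← dot_cross, h.cross, h.nn]
  have h2 : trip (F.place u) (F.place v) (F.place w) = trip F.x F.t F.n * trip u v w := by
    simp only [place, trip_eq, Pi.add_apply, Pi.smul_apply, smul_eq_mul]; ring
  rw [h2, h1, one_mul]

theorem IsOrtho.expand {F : Frame} (h : F.IsOrtho) {v : V3} (hv : F.x ⬝ᵥ v = 0) :
    v = (F.t ⬝ᵥ v) • F.t + (F.n ⬝ᵥ v) • F.n := by
  have hc : F.t ⨯₃ F.n ≠ 0 := by
    rw [h.cross_tn]
    intro h0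
    have := h.xx
    rw [h0, zero_dotProduct] at this
    exact zero_ne_one this
  obtain ⟨α, β, hab⟩ := exists_comb_of_trip_eq_zero hc
    (show trip F.t F.n v = 0 by rw [← dot_cross, h.cross_tn, hv])
  have h1 : F.t ⬝ᵥ v = α := by
    rw [hab, dotProduct_add, dotProduct_smul, dotProduct_smul, h.tt, h.tn]; simp
  have h2 : F.n ⬝ᵥ v = β := by
    rw [hab, dotProduct_add, dotProduct_smul, dotProduct_smul, h.nn, h.nt]; simp
  rw [h1, h2, hab]

end Frame

/-- The points `x 0, …, x (N - 1)` on the unit sphere, repeated with period `N`, are the vertices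
of a convex polygon with the interior on the left. -/
structure PositivePolygon (N : ℕ) (x : ℕ → V3) : Prop where
  periodic : ∀ i, x (i + N) = x i
  unit : ∀ i, x i ⬝ᵥ x i = 1
  ne : ∀ i j, i < j → j < i + N → x i ≠ x j
  step : ∀ i, x i ⨯₃ x (i + 1) ≠ 0
  support : ∀ i l, 0 ≤ trip (x i) (x (i + 1)) (x l)
  exists_pos : ∀ i, ∃ l < N, 0 < trip (x i) (x (i + 1)) (x l)

/-- The length of the edge from `x i` to `x (i + 1)`. -/
noncomputable def edge (x : ℕ → V3) (i : ℕ) : ℝ := Real.arccos (x i ⬝ᵥ x (i + 1))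

/-- The frame at `x i` that points along the edge to `x (i + 1)`. -/
noncomputable def edgeFrame (x : ℕ → V3) (i : ℕ) : Frame where
  x := x i
  t := (Real.sin (edge x i))⁻¹ • (x (i + 1) - Real.cos (edge x i) • x i)
  n := x i ⨯₃ ((Real.sin (edge x i))⁻¹ • (x (i + 1) - Real.cos (edge x i) • x i))

/-- The exterior angle at `x i`. -/
noncomputable def turnAt (x : ℕ → V3) : ℕ → ℝ
  | 0 => 0
  | i + 1 => Real.arccos
      ((Frame.advance (edge x i) (edgeFrame x i)).t ⬝ᵥ (edgeFrame x (i + 1)).t)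

namespace PositivePolygon

variable {N : ℕ} {x : ℕ → V3} (h : PositivePolygon N x)

include h

theorem shift (b : ℕ) : PositivePolygon N fun i => x (b + i) where
  periodic i := by rw [← add_assoc, h.periodic]
  unit i := h.unit _
  ne i j h1 h2 := h.ne _ _ (by omega) (by omega)
  step i := h.step _
  support i l := h.support _ _
  exists_pos i := by
    by_contra! hcon
    have hper : ∀ j m, x (j + m * N) = x j := by
      intro j m
      induction m with
      | zero => rw [zero_mul, add_zero]
      | succ m ih => rw [add_mul, one_mul, ← add_assoc, h.periodic, ih]
    obtain ⟨l, hl, hpos⟩ := h.exists_pos (b + i)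
    have hN : 0 < N := by omega
    have h1 := hcon ((l + b * (N - 1)) % N) (Nat.mod_lt _ hN)
    have h2 : x (b + (l + b * (N - 1)) % N) = x l := by
      rw [← hper _ ((l + b * (N - 1)) / N), add_assoc, mul_comm _ N, Nat.mod_add_div,
        show b + (l + b * (N - 1)) = l + b * N by
          obtain ⟨M, rfl⟩ : ∃ M, N = M + 1 := ⟨N - 1, by omega⟩
          rw [Nat.add_sub_cancel]; ring, hper]
    rw [h2] at h1
    exact absurd hpos (not_lt.mpr h1)

theorem trip_nonneg {i j l : ℕ} (hij : i < j) (hjl : j < l) (hl : l < i + N) :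
    0 ≤ trip (x i) (x j) (x l) := by
  have h' := h.shift i
  have := trip_nonneg_of_support h'.periodic h'.unit h'.ne h'.step h'.support (h'.exists_pos 0)
    (j := j - i) (l := l - i) (by omega) (by omega) (by omega)
  simpa only [add_zero, show i + (j - i) = j by omega, show i + (l - i) = l by omega] using this

theorem edge_mem (i : ℕ) : 0 < edge x i ∧ edge x i < Real.pi := by
  obtain ⟨l, -, hl⟩ := h.exists_pos i
  have := abs_dot_lt_one (h.unit i) (h.unit (i + 1)) hl.ne'
  exact arccos_mem this.1 this.2

theorem cos_edge (i : ℕ) : Real.cos (edge x i) = x i ⬝ᵥ x (i + 1) := by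
  obtain ⟨l, -, hl⟩ := h.exists_pos i
  have := abs_dot_lt_one (h.unit i) (h.unit (i + 1)) hl.ne'
  exact Real.cos_arccos this.1.le this.2.le

theorem sin_edge_pos (i : ℕ) : 0 < Real.sin (edge x i) :=
  Real.sin_pos_of_pos_of_lt_pi (h.edge_mem i).1 (h.edge_mem i).2

theorem sin_smul_edgeFrame (i : ℕ) : Real.sin (edge x i) • (edgeFrame x i).t =
    x (i + 1) - Real.cos (edge x i) • x i :=
  smul_inv_smul₀ (h.sin_edge_pos i).ne' _

theorem advance_edgeFrame (i : ℕ) :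
    (Frame.advance (edge x i) (edgeFrame x i)).x = x (i + 1) := by
  rw [Frame.advance, h.sin_smul_edgeFrame]
  simp [edgeFrame]

theorem edgeFrame_isOrtho (i : ℕ) : (edgeFrame x i).IsOrtho := by
  have e := Real.sin_sq_add_cos_sq (edge x i)
  have hs := (h.sin_edge_pos i).ne'
  have hd : x i ⬝ᵥ (x (i + 1) - Real.cos (edge x i) • x i) = 0 := by
    rw [dotProduct_sub, dotProduct_smul, h.unit, h.cos_edge]; simp
  refine ⟨h.unit i, ?_, ?_, rfl⟩
  · have : (x (i + 1) - Real.cos (edge x i) • x i) ⬝ᵥ (x (i + 1) - Real.cos (edge x i) • x i)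
        = Real.sin (edge x i) ^ 2 := by
      rw [sub_dotProduct, smul_dotProduct, hd, dotProduct_sub, dotProduct_smul, h.unit,
        dotProduct_comm, ← h.cos_edge]
      simp only [smul_eq_mul]
      linear_combination -e
    simp only [edgeFrame, smul_dotProduct, dotProduct_smul, this, smul_eq_mul]
    field_simp
  · simp only [edgeFrame, dotProduct_smul, hd, smul_zero]

theorem edgeFrame_succ_orthogonal (i : ℕ) :
    (Frame.advance (edge x i) (edgeFrame x i)).x ⬝ᵥ (edgeFrame x (i + 1)).t = 0 := by
  rw [h.advance_edgeFrame]
  exact (h.edgeFrame_isOrtho (i + 1)).xt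

theorem sin_edge_mul_sin_edge (i : ℕ) : Real.sin (edge x i) * (Real.sin (edge x (i + 1)) *
    ((edgeFrame x i).n ⬝ᵥ (edgeFrame x (i + 1)).t)) =
      trip (x i) (x (i + 1)) (x (i + 2)) := by
  have h1 := (h.edgeFrame_isOrtho i).trip_advance (edge x i) (x (i + 2))
  rw [h.advance_edgeFrame] at h1
  change trip (x i) _ _ = _ at h1
  have h2 : x (i + 2) = Real.cos (edge x (i + 1)) • x (i + 1)
      + Real.sin (edge x (i + 1)) • (edgeFrame x (i + 1)).t := by
    rw [h.sin_smul_edgeFrame]; simp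
  have h3 : (edgeFrame x i).n ⬝ᵥ x (i + 1) = 0 := by
    rw [← h.advance_edgeFrame]
    exact ((h.edgeFrame_isOrtho i).advance (edge x i)).nx
  rw [h1]
  rw [h2, dotProduct_add, dotProduct_smul, dotProduct_smul, h3]
  simp

theorem dot_sq_add_dot_sq (i : ℕ) :
    ((Frame.advance (edge x i) (edgeFrame x i)).t ⬝ᵥ (edgeFrame x (i + 1)).t) ^ 2
      + ((edgeFrame x i).n ⬝ᵥ (edgeFrame x (i + 1)).t) ^ 2 = 1 := by
  have hG := (h.edgeFrame_isOrtho i).advance (edge x i)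
  have hexp := hG.expand (h.edgeFrame_succ_orthogonal i)
  have htt := (h.edgeFrame_isOrtho (i + 1)).tt
  nth_rewrite 1 [hexp] at htt
  rw [add_dotProduct, smul_dotProduct, smul_dotProduct] at htt
  simp only [smul_eq_mul] at htt
  rw [← htt]
  change _ = _ + (edgeFrame x i).n ⬝ᵥ _ * ((edgeFrame x i).n ⬝ᵥ _)
  ring

theorem cos_turnAt (i : ℕ) : Real.cos (turnAt x (i + 1)) =
    (Frame.advance (edge x i) (edgeFrame x i)).t ⬝ᵥ (edgeFrame x (i + 1)).t := by
  have hle := abs_le.mp ((sq_le_one_iff_abs_le_one _).mp (show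
    ((Frame.advance (edge x i) (edgeFrame x i)).t ⬝ᵥ (edgeFrame x (i + 1)).t) ^ 2 ≤ 1 by
      nlinarith [h.dot_sq_add_dot_sq i, sq_nonneg ((edgeFrame x i).n ⬝ᵥ (edgeFrame x (i + 1)).t)]))
  exact Real.cos_arccos hle.1 hle.2

theorem sin_turnAt (i : ℕ) : Real.sin (turnAt x (i + 1)) =
    (edgeFrame x i).n ⬝ᵥ (edgeFrame x (i + 1)).t := by
  have hnn : 0 ≤ (edgeFrame x i).n ⬝ᵥ (edgeFrame x (i + 1)).t := by
    have h1 := h.sin_edge_mul_sin_edge i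
    have h2 := h.support i (i + 2)
    rw [← h1] at h2
    exact nonneg_of_mul_nonneg_right (nonneg_of_mul_nonneg_right h2 (h.sin_edge_pos i))
      (h.sin_edge_pos (i + 1))
  rw [turnAt, Real.sin_arccos, ← Real.sqrt_sq hnn]
  congr 1
  linarith [h.dot_sq_add_dot_sq i]

/-- An unsigned angle determines the rotation because convexity makes the sine of the turn
nonnegative. -/
theorem edgeFrame_succ (i : ℕ) : edgeFrame x (i + 1) =
    Frame.turn (turnAt x (i + 1)) (Frame.advance (edge x i) (edgeFrame x i)) := by
  have hG := (h.edgeFrame_isOrtho i).advance (edge x i)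
  have ht : (edgeFrame x (i + 1)).t =
      (Frame.turn (turnAt x (i + 1)) (Frame.advance (edge x i) (edgeFrame x i))).t := by
    rw [Frame.turn, h.cos_turnAt, h.sin_turnAt]
    exact hG.expand (h.edgeFrame_succ_orthogonal i)
  have hx : (edgeFrame x (i + 1)).x =
      (Frame.turn (turnAt x (i + 1)) (Frame.advance (edge x i) (edgeFrame x i))).x :=
    (h.advance_edgeFrame i).symm
  have hn : (edgeFrame x (i + 1)).n =
      (Frame.turn (turnAt x (i + 1)) (Frame.advance (edge x i) (edgeFrame x i))).n := by
    rw [← (h.edgeFrame_isOrtho (i + 1)).cross, ← (hG.turn _).cross, ht, hx]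
  cases hF : edgeFrame x (i + 1)
  rw [hF] at ht hx hn
  simp only at ht hx hn
  rw [ht, hx, hn]

/-- A turn by π would reverse the normal, so a vertex strictly left of one edge would be strictly
right of the next. -/
theorem turnAt_mem (i : ℕ) : 0 ≤ turnAt x i ∧ turnAt x i < Real.pi := by
  cases i with
  | zero => exact ⟨le_rfl, Real.pi_pos⟩
  | succ i =>
    refine ⟨Real.arccos_nonneg _, lt_of_le_of_ne (Real.arccos_le_pi _) fun he => ?_⟩
    obtain ⟨l, -, hl⟩ := h.exists_pos i
    have h1 := h.edgeFrame_succ i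
    have he' : turnAt x (i + 1) = Real.pi := he
    have h2 := congrArg Frame.n h1
    rw [he'] at h2
    simp only [Frame.turn, Frame.advance, Real.sin_pi, Real.cos_pi, neg_zero, zero_smul, zero_add,
      neg_smul, one_smul] at h2
    have h3 := (h.edgeFrame_isOrtho i).trip_advance (edge x i) (x l)
    have h4 := (h.edgeFrame_isOrtho (i + 1)).trip_advance (edge x (i + 1)) (x l)
    rw [h.advance_edgeFrame] at h3 h4
    change trip (x i) _ _ = _ at h3
    change trip (x (i + 1)) _ _ = _ at h4
    rw [h2, neg_dotProduct] at h4
    have h5 := h.support (i + 1) l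
    rw [h3] at hl
    rw [h4] at h5
    have h6 := (pos_iff_pos_of_mul_pos hl).mp (h.sin_edge_pos i)
    nlinarith [mul_pos (h.sin_edge_pos (i + 1)) h6]

/-- A chain with the edge lengths `k * ℓ i` and the turns `τ i` is congruent to the model chain. -/
theorem edgeFrame_eq_place {ℓ τ : ℕ → ℝ} {k : ℝ} {n : ℕ} (hℓ : ∀ i < n, edge x i = k * ℓ i)
    (hτ : ∀ i, i + 1 < n → turnAt x (i + 1) = τ (i + 1)) {j : ℕ} (hj : j < n) :
    (edgeFrame x j).x = (edgeFrame x 0).place (frame ℓ τ k j).x ∧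
    (edgeFrame x j).t = (edgeFrame x 0).place (frame ℓ τ k j).t ∧
    (edgeFrame x j).n = (edgeFrame x 0).place (frame ℓ τ k j).n := by
  induction j with
  | zero => simp [frame, Frame.place]
  | succ j ih =>
    obtain ⟨h1, h2, h3⟩ := ih (by omega)
    rw [h.edgeFrame_succ, hℓ j (by omega), hτ j hj]
    simp only [frame, Frame.turn, Frame.advance, Frame.place_comb, h1, h2, h3, and_self]

theorem eq_place {ℓ τ : ℕ → ℝ} {k : ℝ} {n : ℕ} (hℓ : ∀ i < n, edge x i = k * ℓ i)
    (hτ : ∀ i, i + 1 < n → turnAt x (i + 1) = τ (i + 1)) {j : ℕ} (hj : j ≤ n) :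
    x j = (edgeFrame x 0).place (pt ℓ τ k j) := by
  cases j with
  | zero => simp [pt, frame, Frame.place, edgeFrame]
  | succ j =>
    obtain ⟨h1, h2, -⟩ := h.edgeFrame_eq_place hℓ hτ (show j < n by omega)
    rw [← h.advance_edgeFrame, hℓ j (by omega), pt_succ]
    simp only [Frame.advance, Frame.place_comb, h1, h2]

theorem chord_eq {ℓ τ : ℕ → ℝ} {k : ℝ} {n : ℕ} (hℓ : ∀ i < n, edge x i = k * ℓ i)
    (hτ : ∀ i, i + 1 < n → turnAt x (i + 1) = τ (i + 1)) :
    chord ℓ τ k 0 n = Real.arccos (x 0 ⬝ᵥ x n) := by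
  rw [h.eq_place hℓ hτ (Nat.zero_le n), h.eq_place hℓ hτ le_rfl,
    (h.edgeFrame_isOrtho 0).place_dot, chord]

end PositivePolygon

/-- The comparison of two convex chains with proportional edge lengths and equal angles. -/
theorem PositivePolygon.arccos_div_lt {n : ℕ} {x : ℕ → V3} (h : PositivePolygon (n + 1) x) {x' : ℕ → V3}
    (h' : PositivePolygon (n + 1) x') {k k' : ℝ} (hk' : 0 < k') (hkk' : k' < k)
    (hedge : ∀ i < n, edge x' i / k' = edge x i / k)
    (hturn : ∀ i, i + 1 < n → turnAt x' (i + 1) = turnAt x (i + 1)) :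
    Real.arccos (x 0 ⬝ᵥ x n) / k < Real.arccos (x' 0 ⬝ᵥ x' n) / k' := by
  have hk : 0 < k := hk'.trans hkk'
  set ℓ : ℕ → ℝ := fun i => edge x i / k with hℓdef
  have hℓ : ∀ i, 0 < ℓ i := fun i => div_pos (h.edge_mem i).1 hk
  have hkℓ : ∀ i, edge x i = k * ℓ i := fun i => (mul_div_cancel₀ _ hk.ne').symm
  have hkℓ' : ∀ i < n, edge x' i = k' * ℓ i := fun i hi => by
    rw [hℓdef]; simp only; rw [← hedge i hi, mul_div_cancel₀ _ hk'.ne']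
  rw [← h.chord_eq (fun i _ => hkℓ i) (fun _ _ => rfl), ← h'.chord_eq hkℓ' hturn]
  have htrip : ∀ i j l, i ≤ n → j ≤ n → l ≤ n →
      trip (pt ℓ (turnAt x) k i) (pt ℓ (turnAt x) k j) (pt ℓ (turnAt x) k l) =
        trip (x i) (x j) (x l) := by
    intro i j l hi hj hl
    have e := fun {j} (hj : j ≤ n) =>
      h.eq_place (n := n) (τ := turnAt x) (fun i _ => hkℓ i) (fun _ _ => rfl) hj
    rw [e hi, e hj, e hl, (h.edgeFrame_isOrtho 0).place_trip]
  have hc : OrderedConvex (pt ℓ (turnAt x) k) 0 n := by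
    intro i j l h1 h2 h3 h4
    rw [htrip i j l (by omega) (by omega) (by omega)]
    exact h.trip_nonneg h2 h3 (by omega)
  refine chord_div_lt hℓ h.turnAt_mem hk' n 0 n k (by omega) hkk'
    (fun i => by rw [← hkℓ]; exact (h.edge_mem i).2) ?_ hc ?_
  · rintro i j - hij hjn hs
    obtain ⟨l, hl, hpos⟩ := h.exists_pos i
    rw [← htrip i (i + 1) l (by omega) (by omega) (by omega)] at hpos
    have ho := frame_isOrtho (ℓ := ℓ) (τ := turnAt x) k i
    have hsin : ∀ m, i < m → m ≤ j →
        trip (pt ℓ (turnAt x) k i) (pt ℓ (turnAt x) k m) (pt ℓ (turnAt x) k l) =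
        Real.sin (k * (∑ m ∈ Finset.range m, ℓ m - ∑ m ∈ Finset.range i, ℓ m))
          * ((frame ℓ (turnAt x) k i).n ⬝ᵥ pt ℓ (turnAt x) k l) := by
      intro m h1 h2
      rw [pt_straight h1 fun a h3 h4 => hs a h3 (by omega), pt, ho.trip_advance]
    -- The witness `l` off the great circle of the run cannot belong to the run. On either side of
    -- it, weak convexity keeps the sine of each partial length of the run nonnegative.
    have hl' : l < i ∨ j < l := by
      by_contra! hcon
      rcases eq_or_lt_of_le hcon.1 with rfl | h1
      · rw [trip_outer_eq] at hpos; exact lt_irrefl _ hpos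
      rcases eq_or_lt_of_le (show i + 1 ≤ l from h1) with rfl | h2
      · rw [trip_right_eq] at hpos; exact lt_irrefl _ hpos
      rw [trip_straight (by omega) h2 fun m h3 h4 => hs m h3 (by omega)] at hpos
      exact lt_irrefl _ hpos
    have hn : 0 < (frame ℓ (turnAt x) k i).n ⬝ᵥ pt ℓ (turnAt x) k l := by
      rw [pt_succ, pt, ho.trip_advance, ← hkℓ] at hpos
      exact (pos_iff_pos_of_mul_pos hpos).mp (h.sin_edge_pos i)
    have hnn : ∀ m, i < m → m ≤ j →
        0 ≤ Real.sin (k * (∑ m ∈ Finset.range m, ℓ m - ∑ m ∈ Finset.range i, ℓ m)) := by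
      intro m h1 h2
      refine nonneg_of_mul_nonneg_left ?_ hn
      rw [← hsin m h1 h2]
      rcases hl' with h3 | h3
      · rw [← trip_rot]
        exact hc _ _ _ (Nat.zero_le _) h3 h1 (by omega)
      · exact hc _ _ _ (Nat.zero_le _) h1 (by omega) (by omega)
    have hle : ∀ m, i ≤ m → m ≤ j →
        k * (∑ m ∈ Finset.range m, ℓ m - ∑ m ∈ Finset.range i, ℓ m) ≤ Real.pi := by
      intro m him
      induction m, him using Nat.le_induction with
      | base => intro _; rw [sub_self, mul_zero]; exact Real.pi_pos.le
      | succ m hm ih =>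
        intro hmj
        have h1 := ih (by omega)
        have h2 := hnn (m + 1) (by omega) hmj
        have h3 := (h.edge_mem m).2
        rw [hkℓ] at h3
        rw [Finset.sum_range_succ] at h2 ⊢
        -- A single edge is shorter than π, so a partial length cannot jump from at most π past the
        -- interval (π, 2π), where the sine is negative.
        by_contra! hcon
        have := Real.sin_neg_of_neg_of_neg_pi_lt
          (x := k * (∑ m ∈ Finset.range m, ℓ m + ℓ m - ∑ m ∈ Finset.range i, ℓ m)
            - 2 * Real.pi) (by nlinarith) (by linarith)
        rw [Real.sin_sub_two_pi] at this
        linarith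
    exact hle j hij.le le_rfl
  · by_contra! hcon
    obtain ⟨l, hl, hpos⟩ := h.exists_pos 0
    rcases Nat.lt_or_ge l 2 with h1 | h1
    · have : l = 0 ∨ l = 1 := by omega
      rcases this with rfl | rfl
      · rw [trip_outer_eq] at hpos; exact lt_irrefl _ hpos
      · rw [trip_right_eq] at hpos; exact lt_irrefl _ hpos
    · rw [← htrip 0 (0 + 1) l (by omega) (by omega) (by omega),
        trip_straight (by omega) (by omega) fun m h3 h4 => hcon m h3 (by omega)] at hpos
      exact lt_irrefl _ hpos

/-! ### Passage from spheres of radius r to the unit sphere -/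

/-- The index `i` modulo `n + 1`. -/
def idx (n i : ℕ) : Fin (n + 1) := ⟨i % (n + 1), Nat.mod_lt _ (Nat.succ_pos n)⟩

theorem idx_succ (n i : ℕ) : idx n (i + 1) = idx n i + 1 := by
  apply Fin.ext
  simp [idx, Fin.val_add]

theorem idx_val {n : ℕ} (i : Fin (n + 1)) : idx n i = i :=
  Fin.ext (Nat.mod_eq_of_lt i.isLt)

theorem tripleProduct_eq (a b d : E3) : tripleProduct a b d = trip a b d := by
  simp [tripleProduct, trip_eq, Matrix.det_fin_three]; ring

theorem inner_eq (a b : E3) : inner ℝ a b = (a : V3) ⬝ᵥ (b : V3) := by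
  rw [PiLp.inner_apply, dotProduct]
  simp [mul_comm]

/-- The vertices of a polygon, multiplied by `c` and repeated periodically. -/
def scaled (c : ℝ) {n : ℕ} (v : Fin (n + 1) → E3) (i : ℕ) : V3 := c • (v (idx n i) : V3)

theorem exists_orthogonal_ne_zero (w : V3) : ∃ u : V3, u ≠ 0 ∧ u ⬝ᵥ w = 0 := by
  by_cases h : w 0 = 0
  · exact ⟨![1, 0, 0], fun h0 => by simpa using congrFun h0 0, by rw [dot_eq]; simp [h]⟩
  · exact ⟨![-w 1, w 0, 0], fun h0 => h (by simpa using congrFun h0 1),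
      by rw [dot_eq]; simp; ring⟩

section Scaled

variable {r c : ℝ} {n : ℕ} {v : Fin (n + 1) → E3}

theorem scaled_dot (i j : ℕ) :
    scaled c v i ⬝ᵥ scaled c v j = c ^ 2 * inner ℝ (v (idx n i)) (v (idx n j)) := by
  rw [inner_eq]
  simp only [scaled, smul_dotProduct, dotProduct_smul, smul_eq_mul]; ring

theorem scaled_trip (i j l : ℕ) : trip (scaled c v i) (scaled c v j) (scaled c v l) =
    c ^ 3 * tripleProduct (v (idx n i)) (v (idx n j)) (v (idx n l)) := by
  rw [tripleProduct_eq]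
  simp only [scaled, trip_eq, Pi.smul_apply, smul_eq_mul]; ring

theorem scaled_injective (hc : c ≠ 0) {i j : ℕ} (h : scaled c v i = scaled c v j) :
    v (idx n i) = v (idx n j) := by
  have := smul_right_injective V3 hc h
  exact PiLp.ext fun a => congrFun this a

theorem scaled_unit (hv : IsConvexSphericalPolygon r v) (hc : c ^ 2 * r ^ 2 = 1) (i : ℕ) :
    scaled c v i ⬝ᵥ scaled c v i = 1 := by
  have h := hv.mem_sphere (idx n i)
  rw [mem_sphere_zero_iff_norm] at h
  rw [scaled_dot, real_inner_self_eq_norm_sq, h, hc]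

theorem positivePolygon_scaled (hv : IsConvexSphericalPolygon r v) (hc : c ^ 2 * r ^ 2 = 1)
    (hsup : ∀ i k, 0 ≤ c ^ 3 * tripleProduct (v i) (v (i + 1)) (v k)) :
    PositivePolygon (n + 1) (scaled c v) := by
  have hc0 : c ≠ 0 := by rintro rfl; simp at hc
  have hgc : ∀ u : V3, u ≠ 0 → ∃ l < n + 1, u ⬝ᵥ scaled c v l ≠ 0 := by
    intro u hu
    by_contra! hcon
    refine hv.not_great_circle ⟨WithLp.toLp 2 u, fun h => hu ?_, fun i => ?_⟩
    · simpa using h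
    · have h1 := hcon i i.isLt
      rw [scaled, idx_val, dotProduct_smul, smul_eq_mul] at h1
      rw [inner_eq]
      exact (mul_eq_zero.mp h1).resolve_left hc0
  have hn : 0 < n := by
    rcases Nat.eq_zero_or_pos n with rfl | hn
    · obtain ⟨u, hu, hu'⟩ := exists_orthogonal_ne_zero (scaled c v 0)
      obtain ⟨l, hl, hl'⟩ := hgc u hu
      rw [show l = 0 by omega] at hl'
      exact absurd hu' hl'
    · exact hn
  have hunit := scaled_unit hv hc
  have hne : ∀ i j, i < j → j < i + (n + 1) → scaled c v i ≠ scaled c v j := by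
    intro i j h1 h2 h3
    have h4 := congrArg Fin.val (hv.injective (scaled_injective hc0 h3))
    have h5 : n + 1 ∣ j - i := (Nat.modEq_iff_dvd' h1.le).mp h4
    have := Nat.le_of_dvd (by omega) h5
    omega
  have hstep : ∀ i, scaled c v i ⨯₃ scaled c v (i + 1) ≠ 0 := by
    intro i h
    rcases eq_or_eq_neg_of_cross_eq_zero (hunit i) (hunit (i + 1)) h with h1 | h1
    · exact hne i (i + 1) (by omega) (by omega) h1.symm
    · refine hv.not_antipodal (idx n i) ?_
      rw [← idx_succ]
      rw [scaled, scaled, ← smul_neg] at h1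
      have := smul_right_injective V3 hc0 h1
      exact PiLp.ext fun a => congrFun this a
  have hs : ∀ i l, 0 ≤ trip (scaled c v i) (scaled c v (i + 1)) (scaled c v l) := by
    intro i l
    rw [scaled_trip, idx_succ]
    exact hsup _ _
  refine ⟨fun i => ?_, hunit, hne, hstep, hs, fun i => ?_⟩
  · rw [scaled, scaled]
    congr 2
    simp [idx]
  · obtain ⟨l, hl, hl'⟩ := hgc _ (hstep i)
    rw [dot_cross] at hl'
    exact ⟨l, hl, lt_of_le_of_ne (hs i l) hl'.symm⟩

/-- The factor is 1/r or -1/r. The antipodal map preserves inner products and reverses triple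
products, so the negative sign brings a polygon with its interior on the right into positive
position. -/
theorem exists_positivePolygon_scaled (hr : 0 < r) (hv : IsConvexSphericalPolygon r v) :
    ∃ c : ℝ, c ^ 2 * r ^ 2 = 1 ∧ PositivePolygon (n + 1) (scaled c v) := by
  rcases hv.support with h | h
  · have hc : r⁻¹ ^ 2 * r ^ 2 = 1 := by field_simp
    exact ⟨r⁻¹, hc, positivePolygon_scaled hv hc fun i k => mul_nonneg (by positivity) (h i k)⟩
  · have hc : (-r⁻¹) ^ 2 * r ^ 2 = 1 := by field_simp
    refine ⟨-r⁻¹, hc, positivePolygon_scaled hv hc fun i k => ?_⟩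
    rw [show (-r⁻¹) ^ 3 * tripleProduct (v i) (v (i + 1)) (v k)
      = r⁻¹ ^ 3 * (-tripleProduct (v i) (v (i + 1)) (v k)) by ring]
    exact mul_nonneg (by positivity) (neg_nonneg.mpr (h i k))

theorem angle_eq_arccos (hr : 0 < r) (hv : IsConvexSphericalPolygon r v)
    (hc : c ^ 2 * r ^ 2 = 1) (i j : ℕ) :
    InnerProductGeometry.angle (v (idx n i)) (v (idx n j)) =
      Real.arccos (scaled c v i ⬝ᵥ scaled c v j) := by
  have h1 := mem_sphere_zero_iff_norm.mp (hv.mem_sphere (idx n i))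
  have h2 := mem_sphere_zero_iff_norm.mp (hv.mem_sphere (idx n j))
  rw [InnerProductGeometry.angle, h1, h2, scaled_dot]
  congr 1
  rw [div_eq_iff (by positivity)]
  linear_combination (-inner ℝ (v (idx n i)) (v (idx n j))) * hc

theorem sphereDist_eq (hr : 0 < r) (hv : IsConvexSphericalPolygon r v)
    (hc : c ^ 2 * r ^ 2 = 1) (i j : ℕ) :
    sphereDist r (v (idx n i)) (v (idx n j)) =
      Real.arccos (scaled c v i ⬝ᵥ scaled c v j) / r⁻¹ := by
  rw [sphereDist, angle_eq_arccos hr hv hc, div_inv_eq_mul, mul_comm]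

theorem arcDirection_eq (hv : IsConvexSphericalPolygon r v) (hc : c ^ 2 * r ^ 2 = 1) (i j : ℕ) :
    c • arcDirection (v (idx n i)) (v (idx n j)) = WithLp.toLp 2
      (scaled c v j - (scaled c v i ⬝ᵥ scaled c v j) • scaled c v i) := by
  have hc0 : c ≠ 0 := by rintro rfl; simp at hc
  have h1 := mem_sphere_zero_iff_norm.mp (hv.mem_sphere (idx n i))
  have hr0 : r ≠ 0 := by rintro rfl; simp at hc
  have e : inner ℝ (v (idx n i)) (v (idx n j)) / r ^ 2 =
      c ^ 2 * inner ℝ (v (idx n i)) (v (idx n j)) := by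
    rw [div_eq_iff (by positivity)]
    linear_combination (-inner ℝ (v (idx n i)) (v (idx n j))) * hc
  rw [arcDirection, real_inner_self_eq_norm_sq, h1, e, ← scaled_dot]
  ext a
  simp [scaled]
  ring

theorem angle_toLp {a b : V3} (ha : a ⬝ᵥ a = 1) (hb : b ⬝ᵥ b = 1) :
    InnerProductGeometry.angle (WithLp.toLp 2 a : E3) (WithLp.toLp 2 b) =
      Real.arccos (a ⬝ᵥ b) := by
  have hn : ∀ a : V3, a ⬝ᵥ a = 1 → ‖(WithLp.toLp 2 a : E3)‖ = 1 := by
    intro a ha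
    have : ‖(WithLp.toLp 2 a : E3)‖ ^ 2 = 1 := by
      rw [← real_inner_self_eq_norm_sq, inner_eq]; exact ha
    exact (pow_eq_one_iff_of_nonneg (norm_nonneg _) two_ne_zero).mp this
  rw [InnerProductGeometry.angle, hn a ha, hn b hb, inner_eq, mul_one, div_one]

/-- The arc back to the previous vertex leaves opposite to the tangent with which the chain arrives,
so interior and exterior angle add up to π. -/
theorem sphereAngle_eq (hv : IsConvexSphericalPolygon r v) (hc : c ^ 2 * r ^ 2 = 1)
    (hp : PositivePolygon (n + 1) (scaled c v)) (i : ℕ) :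
    sphereAngle (v (idx n i)) (v (idx n (i + 1))) (v (idx n (i + 2))) =
      Real.pi - turnAt (scaled c v) (i + 1) := by
  have hc0 : c ≠ 0 := by rintro rfl; simp at hc
  set x := scaled c v with hx
  have hG := (hp.edgeFrame_isOrtho i).advance (edge x i)
  have hs := hp.sin_edge_pos i
  have hs' := hp.sin_edge_pos (i + 1)
  have e1 : x i - (x (i + 1) ⬝ᵥ x i) • x (i + 1) =
      (-Real.sin (edge x i)) • (Frame.advance (edge x i) (edgeFrame x i)).t := by
    have e0 := hp.sin_smul_edgeFrame i
    have e2 : x (i + 1) = Real.cos (edge x i) • x i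
        + Real.sin (edge x i) • (edgeFrame x i).t := by rw [e0]; simp
    rw [dotProduct_comm, ← hp.cos_edge]
    rw [e2]
    have e3 : (edgeFrame x i).x = x i := rfl
    simp only [Frame.advance, e3]
    rw [show x i - Real.cos (edge x i) • (Real.cos (edge x i) • x i
      + Real.sin (edge x i) • (edgeFrame x i).t) = (1 - Real.cos (edge x i) ^ 2) • x i
      - (Real.cos (edge x i) * Real.sin (edge x i)) • (edgeFrame x i).t by module,
      ← Real.sin_sq]
    module
  have e2 : x (i + 2) - (x (i + 1) ⬝ᵥ x (i + 2)) • x (i + 1) =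
      Real.sin (edge x (i + 1)) • (edgeFrame x (i + 1)).t := by
    rw [hp.sin_smul_edgeFrame, hp.cos_edge]
  rw [sphereAngle, ← InnerProductGeometry.angle_smul_smul hc0, arcDirection_eq hv hc,
    arcDirection_eq hv hc, ← hx, e1, e2, WithLp.toLp_smul, WithLp.toLp_smul,
    InnerProductGeometry.angle_smul_left_of_neg _ _ (neg_neg_of_pos hs),
    InnerProductGeometry.angle_smul_right_of_pos _ _ hs',
    InnerProductGeometry.angle_neg_left, angle_toLp hG.tt (hp.edgeFrame_isOrtho (i + 1)).tt,
    turnAt]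

end Scaled

end SphericalChain

open SphericalChain in
theorem theorem3p2 (r r' : ℝ) (hr : 0 < r) (hrr' : r < r') (n : ℕ)
    (v v' : Fin (n + 1) → E3)
    (hv : IsConvexChain r v) (hv' : IsConvexChain r' v')
    (hlen : SameEdgeLengths r r' v v') (hang : SameAngles v v') :
    sphereDist r (v 0) (v (Fin.last n)) < sphereDist r' (v' 0) (v' (Fin.last n)) := by
  have hr' : 0 < r' := hr.trans hrr'
  obtain ⟨c, hc, hp⟩ := exists_positivePolygon_scaled hr hv
  obtain ⟨c', hc', hp'⟩ := exists_positivePolygon_scaled hr' hv'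
  have e0 : idx n 0 = 0 := idx_val 0
  have en : idx n n = Fin.last n := idx_val (Fin.last n)
  rw [← e0, ← en, sphereDist_eq hr hv hc, sphereDist_eq hr' hv' hc']
  refine hp.arccos_div_lt hp' (inv_pos.mpr hr') ((inv_lt_inv₀ hr' hr).mpr hrr') ?_ ?_
  · intro i hi
    have h := hlen ⟨i, hi⟩
    have e1 : Fin.castSucc ⟨i, hi⟩ = idx n i := (idx_val (Fin.castSucc ⟨i, hi⟩)).symm
    have e2 : Fin.succ ⟨i, hi⟩ = idx n (i + 1) := (idx_val (Fin.succ ⟨i, hi⟩)).symm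
    rw [e1, e2, sphereDist_eq hr hv hc, sphereDist_eq hr' hv' hc'] at h
    exact h
  · intro i hi
    have hval : (idx n (i + 1)).val = i + 1 := Nat.mod_eq_of_lt (by omega)
    have h := hang (idx n (i + 1)) (fun h0 => by rw [h0] at hval; simp at hval)
      (fun h0 => by rw [h0] at hval; simp at hval; omega)
    have e1 : idx n (i + 1) - 1 = idx n i := by rw [idx_succ, add_sub_cancel_right]
    rw [e1, ← idx_succ, sphereAngle_eq hv hc hp, sphereAngle_eq hv' hc' hp'] at h
    linarith
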